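/- **Setting.** Let $D$ be a skew field that is finite dimensional over its center $C(D)$, let $\sigma$ be an automorphism of $D$ of finite order, and let $R=D[X;\sigma]$ be the skew polynomial ring with $Xa=\sigma(a)X$. Put $K=C(D)\cap D^\sigma$, $\mu=\dim_K D$, and let $r$ be the rank of $R$ over its center. The arithmetic of $D$ is carried out by some implementation in terms of basic operations of $K$, and $S(\mu)$, $M(\mu)$, $I(\mu)$, $A(\mu)$ are upper bounds for the number of basic operations needed, respectively, for one addition or subtraction in $D$, one multiplication, one inversion, and one application of a power of $\sigma$. Let $d_1,\dots,d_s\in R$ generate $R$ as an algebra over its center, with $\deg d_i\le m$ for all $i$ (for instance $m=1$ for $d_1,\dots,d_{s-1}\in D$, $d_s=X$). **Algorithm.** For nonzero $f\in R$ the following algorithm computes the bound $f^*$ of $f$, that is, a skew polynomial with $\operatorname{Ann}_R(R/Rf)=Rf^*=f^*R$. Start with $g=f$ and $i=1$. While $i\le s$: if the left remainder of $gd_i$ by $g$ is $0$, replace $i$ by $i+1$; otherwise compute a generator $a$ of $\operatorname{Ann}_R(d_i+Rg)$, replace $g$ by the left least common multiple of $a$ and $g$, and set $i=1$. Finally return $g$.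 Here products are computed by the standard method; left remainders by left Euclidean division ($f=cg+t$ with $\deg t<\deg g$); a generator of $\operatorname{Ann}_R(h+Rg)$ by the extended left Euclidean algorithm applied to $g,h$, in which only the cofactors of $h$ are computed; and the left least common multiple of $a$ and $g$ as $va$, where $t$ is the left remainder of $a$ by $g$ and $v$ is the generator of $\operatorname{Ann}_R(t+Rg)$ computed in the same way. **Theorem.** For every $m\in\mathbb N$ there is a constant $C$, depending only on $m$, such that in every such setting and for every $f\in R$ of degree $n\ge 1$ the algorithm halts and returns a bound of $f$, and, with $$B=\sqrt r\,s\,n\,I(\mu)+r\sqrt r\,n^3\,S(\mu)+s\,r\,n^2\,\bigl(M(\mu)+A(\mu)\bigr),$$ the number of basic operations that it uses is at most $C\,B$, provided that $s\le\sqrt r\,n$ (which for a fixed ring and fixed generators holds for all large $n$) or that $S(\mu)\le M(\mu)$. Without this proviso, for all $n\ge 1$, the number of basic operations is at most $C\,(s+1)\,B$. In this sense it belongs to $$\mathcal O\bigl(\sqrt r\,s\,n\,I(\mu)+r\sqrt r\,n^3S(\mu)+s\,r\,n^2(M(\mu)+A(\mu))\bigr).$$ -/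

import Mathlib

namespace OreBound

universe u

/-! ### Computations that may diverge and that count basic operations -/

/-- A computation with result in `α`: if it halts it yields its result together with the
number of basic operations that it used; it may also diverge. -/
structure Comp (α : Type u) : Type u where
  run : Part (α × ℕ)

/-- The computation that uses `c` basic operations and returns `a`. -/
def charge {α : Type u} (c : ℕ) (a : α) : Comp α := ⟨Part.some (a, c)⟩

/-- Sequential composition adds the numbers of operations. -/
instance : Monad Comp where
  pure a := charge 0 a
  bind x k := ⟨x.run.bind fun p => (k p.1).run.map fun q => (q.1, p.2 + q.2)⟩

/-- `Halts x a c`: the computation `x` halts, returns `a`, and uses exactly `c` basic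
operations. -/
def Halts {α : Type u} (x : Comp α) (a : α) (c : ℕ) : Prop :=
  (a, c) ∈ x.run

open Classical in
/-- One test of the `while` loop on a state with the operations counted so far: leave the loop
(`Sum.inl`), or run `body` and go on (`Sum.inr`). -/
noncomputable def whileStep {τ : Type u} (cond : τ → Prop) (body : τ → Comp τ) :
    τ × ℕ →. (τ × ℕ) ⊕ (τ × ℕ) :=
  fun p =>
    if cond p.1 then (body p.1).run.map fun q => Sum.inr (q.1, p.2 + q.2)
    else Part.some (Sum.inl p)

/-- The `while` loop: as long as the state satisfies `cond`, replace it by the result of `body`.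
It diverges if `cond` never becomes false. -/
noncomputable def whileLoop {τ : Type u} (cond : τ → Prop) (body : τ → Comp τ) (start : τ) :
    Comp τ :=
  ⟨(whileStep cond body).fix (start, 0)⟩

/-! ### Arithmetic of the skew field -/

/-- The numbers of basic operations that the chosen implementation of the arithmetic of `D`
spends on given operands: on `a + b`, `a - b`, `a * b`, `a⁻¹`, and `σ ^ i` applied to `a`. -/
structure ArithCost (D : Type u) where
  add : D → D → ℕ
  sub : D → D → ℕ
  mul : D → D → ℕ
  inv : D → ℕ
  pow : ℕ → D → ℕ

/-- `S`, `M`, `I`, `A` bound the cost of every addition or subtraction, of every multiplication,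
of every inversion, and of every application of a power of `σ`. -/
structure ArithCost.BoundedBy {D : Type u} (κ : ArithCost D) (S M I A : ℝ) : Prop where
  add_le : ∀ a b, (κ.add a b : ℝ) ≤ S
  sub_le : ∀ a b, (κ.sub a b : ℝ) ≤ S
  mul_le : ∀ a b, (κ.mul a b : ℝ) ≤ M
  inv_le : ∀ a, (κ.inv a : ℝ) ≤ I
  pow_le : ∀ i a, (κ.pow i a : ℝ) ≤ A

/-- The commutative field `K` of the central elements of `D` that are fixed by `σ`. -/
def invariantCenter {D : Type u} [DivisionRing D] (σ : RingAut D) : Subring D :=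
  Subring.center D ⊓ RingHom.eqLocus (σ : D →+* D) (RingHom.id D)

section Algorithms

variable {D : Type u} [DivisionRing D] [MulSemiringAction (Multiplicative ℕ) D]

def addD (κ : ArithCost D) (a b : D) : Comp D := charge (κ.add a b) (a + b)

def subD (κ : ArithCost D) (a b : D) : Comp D := charge (κ.sub a b) (a - b)

def mulD (κ : ArithCost D) (a b : D) : Comp D := charge (κ.mul a b) (a * b)

def invD (κ : ArithCost D) (a : D) : Comp D := charge (κ.inv a) a⁻¹

/-- Application of `σ ^ i`; nothing is to be done for `i = 0`. -/
def powD (κ : ArithCost D) (i : ℕ) (a : D) : Comp D :=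
  if i = 0 then pure a else charge (κ.pow i a) (SkewPolynomial.φ^[i] a)

/-- The sum of a list of `l` elements of `D`, by `l - 1` additions. -/
def sumD (κ : ArithCost D) : List D → Comp D
  | [] => pure 0
  | a :: l => l.foldlM (addD κ) a

/-! ### Skew polynomials: degree and dense representation

A variable that holds a skew polynomial is a dense vector of coefficients. Reading a coefficient
or the degree, comparing with `0`, and storing coefficients are not operations of `D`. -/

/-- The degree, with `deg 0 = ⊥`. -/
def degree (f : SkewPolynomial D) : WithBot ℕ := f.support.max

/-- The degree as a natural number, with value `0` at `0`. -/
def natDegree (f : SkewPolynomial D) : ℕ := f.support.sup id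

/-- The number of entries of the coefficient vector: `deg f + 1`, and `0` for `f = 0`. -/
def size (f : SkewPolynomial D) : ℕ := f.support.sup (· + 1)

/-- The leading coefficient. -/
def lc (f : SkewPolynomial D) : D := SkewPolynomial.coeff f (natDegree f)

/-- The skew polynomial `a₀ + a₁ X + a₂ X² + ⋯` with coefficient list `a₀, a₁, a₂, …`. -/
noncomputable def ofCoeffs (l : List D) : SkewPolynomial D :=
  ∑ i ∈ Finset.range l.length, SkewPolynomial.monomial i (l.getD i 0)

/-! ### The algorithms -/

/-- `f - g`, coefficient by coefficient. -/
noncomputable def polySub (κ : ArithCost D) (f g : SkewPolynomial D) :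
    Comp (SkewPolynomial D) := do
  let cs ← (List.range (max (size f) (size g))).mapM fun k =>
    subD κ (SkewPolynomial.coeff f k) (SkewPolynomial.coeff g k)
  pure (ofCoeffs cs)

/-- `f * g` by the standard method: the coefficient of `X ^ k` is the sum of the terms
`fᵢ σⁱ(gⱼ)` with `i + j = k`, `i ≤ deg f`, `j ≤ deg g`. -/
noncomputable def polyMul (κ : ArithCost D) (f g : SkewPolynomial D) :
    Comp (SkewPolynomial D) := do
  let cs ← (List.range (size f + size g - 1)).mapM fun k => do
    let terms ← ((List.range (size f)).filter fun i => i ≤ k ∧ k - i < size g).mapM fun i => do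
      let b ← powD κ i (SkewPolynomial.coeff g (k - i))
      mulD κ (SkewPolynomial.coeff f i) b
    sumD κ terms
  pure (ofCoeffs cs)

/-- `a X ^ k * g`. -/
noncomputable def monomialMul (κ : ArithCost D) (a : D) (k : ℕ) (g : SkewPolynomial D) :
    Comp (SkewPolynomial D) := do
  let cs ← (List.range (size g)).mapM fun j => do
    let b ← powD κ k (SkewPolynomial.coeff g j)
    mulD κ a b
  pure (ofCoeffs (List.replicate k 0 ++ cs))

/-- Left Euclidean division: quotient `c` and remainder `r` with `f = c * g + r` and
`deg r < deg g`. The state of the loop is `(c, r)`. -/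
noncomputable def leftDiv (κ : ArithCost D) (f g : SkewPolynomial D) :
    Comp (SkewPolynomial D × SkewPolynomial D) := do
  let b ← invD κ (lc g)
  whileLoop (fun st => degree g ≤ degree st.2)
    (fun st => do
      let k := natDegree st.2 - natDegree g
      let t ← powD κ k b
      let a ← mulD κ (lc st.2) t
      let e ← addD κ (SkewPolynomial.coeff st.1 k) a
      let p ← monomialMul κ a k g
      let r ← polySub κ st.2 p
      pure (SkewPolynomial.update st.1 k e, r))
    (0, f)

/-- The state `(f₀, f₁, v₀, v₁)` of the short extended Euclidean algorithm. -/
structure EuclidState (D : Type u) [DivisionRing D] where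
  f₀ : SkewPolynomial D
  f₁ : SkewPolynomial D
  v₀ : SkewPolynomial D
  v₁ : SkewPolynomial D

/-- A generator of the left ideal `Ann (h + R f)`, by the short extended left Euclidean
algorithm. -/
noncomputable def annihilatorGen (κ : ArithCost D) (f h : SkewPolynomial D) :
    Comp (SkewPolynomial D) := do
  let cr ← leftDiv κ f h
  let v ← polySub κ 0 cr.1
  let fin ← whileLoop (fun st : EuclidState D => st.f₁ ≠ 0)
    (fun st => do
      let cr ← leftDiv κ st.f₀ st.f₁
      let p ← polyMul κ cr.1 st.v₁
      let v ← polySub κ st.v₀ p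
      pure { f₀ := st.f₁, f₁ := cr.2, v₀ := st.v₁, v₁ := v })
    { f₀ := h, f₁ := cr.2, v₀ := 1, v₁ := v }
  pure fin.v₁

/-- The left least common multiple of `a` and `g`: replace `a` by its left remainder `t` modulo
`g`, compute a generator `v` of `Ann (t + R g) = Ann (a + R g)`, and return `v * a`. -/
noncomputable def leftLcm (κ : ArithCost D) (a g : SkewPolynomial D) :
    Comp (SkewPolynomial D) := do
  let cr ← leftDiv κ a g
  let v ← annihilatorGen κ g cr.2
  polyMul κ v a

open Classical in
/-- The algorithm for the bound of `f`, given the list `gens` of generators `d₁, …, d_s`.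
The state of the loop is `(f*, i)`, where the generators are numbered from `0`. -/
noncomputable def boundII (κ : ArithCost D) (gens : List (SkewPolynomial D))
    (f : SkewPolynomial D) : Comp (SkewPolynomial D) := do
  let fin ← whileLoop (fun st : SkewPolynomial D × ℕ => st.2 < gens.length)
    (fun st => do
      let d := gens.getD st.2 0
      let p ← polyMul κ st.1 d
      let cr ← leftDiv κ p st.1
      if cr.2 = 0 then
        pure (st.1, st.2 + 1)
      else do
        let a ← annihilatorGen κ st.1 d
        let g ← leftLcm κ a st.1
        pure (g, 0))
    (f, 0)
  pure fin.1

/-- `g` is a bound of `f`: `Ann (R / R f) = R g = g R`, where `R = D[X; σ]`. -/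
def IsBound (f g : SkewPolynomial D) : Prop :=
  Module.annihilator (SkewPolynomial D) (SkewPolynomial D ⧸ Ideal.span {f}) = Ideal.span {g} ∧
    ∀ h : SkewPolynomial D, h ∈ Ideal.span {g} ↔ ∃ a, h = g * a

end Algorithms

/-- The rank of `D[X; σ]` over its center. -/
noncomputable def centerRank (D : Type u) [DivisionRing D]
    [MulSemiringAction (Multiplicative ℕ) D] : ℕ :=
  Module.finrank (Subring.center (SkewPolynomial D)) (SkewPolynomial D)

/-- `√r s n I + r √r n³ S + s r n² (M + A)`. -/
noncomputable def costBound (r s n : ℕ) (S M I A : ℝ) : ℝ :=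
  √(r : ℝ) * s * n * I + r * √(r : ℝ) * n ^ 3 * S + s * r * n ^ 2 * (M + A)

end OreBound

namespace OreBound

universe u

/-! ### Skew polynomials over a skew field -/

section Size

variable {D : Type u} [DivisionRing D]

open SkewPolynomial

/-! Let Z be the center of R = D[X; σ], and let b generate the left ideal Ann(R/Rf), which is
two-sided. The loop keeps Rb ⊆ Rg ⊆ Rf. If g d ∉ Rg for a generator d, let Ra = {x : x d ∈ Rg}.
Since b d ∈ Rb ⊆ Rg, b lies in Ra ∩ Rg, which is generated by the new g; its degree is strictly
larger because g ∉ Ra. On exit, {x : g x ∈ Rg} is a Z-subalgebra containing all generators. So Rg is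
two-sided and lies in Rf, hence g kills R/Rf and Rg = Rb (`BoundInv.isBound`). Surjectivity of σ
then gives Rg = gR (`exists_mul_eq_of_twoSided`).

The size of the computation is governed by deg b ≤ √r deg f (`exists_mem_annihilator_natDegree_le`).
If f = g h, an annihilator of R/Rg times one of R/Rh annihilates R/Rf, and degrees add, so Rf may be
taken maximal. Then V = R/Rf is simple with division ring of endomorphisms E. By Jacobson density, k
vectors independent over E yield k² matrix units in R, and these are independent over Z
(`linearIndependent_of_coeff_mem`). Thus dim V ≤ √r over E. An element that kills a basis kills V,
and killing one vector costs degree at most deg f (`exists_smul_eq_zero`).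

The cost is amortized over the growth of deg g, which totals at most deg b. Each test costs one
inversion plus O(deg b) other operations, and at most s tests occur per increase of the degree. The
cost of an update is bounded by the increase it achieves times O(I + N(M + A) + N² S) with N = `size
b`, because the cofactors of the Euclidean algorithm grow exactly as its remainders shrink
(`EuclidSize`). With ρ = √r n the total is O(sρI + sρ²(M + A + S) + ρ³S); the proviso serves only to
absorb the term sρ²S (`le_mul_costBound`). -/

theorem size_le_iff {f : SkewPolynomial D} {n : ℕ} :
    size f ≤ n ↔ ∀ k, n ≤ k → coeff f k = 0 := by
  simp only [size, Finset.sup_le_iff, mem_support_iff, Nat.succ_le_iff]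
  refine forall_congr' fun k => ?_
  rw [← not_imp_not, not_not, not_lt]

theorem coeff_eq_zero_of_size_le {f : SkewPolynomial D} {k : ℕ} (h : size f ≤ k) :
    coeff f k = 0 :=
  size_le_iff.1 h k le_rfl

theorem lt_size_of_coeff_ne_zero {f : SkewPolynomial D} {k : ℕ} (h : coeff f k ≠ 0) :
    k < size f :=
  lt_of_not_ge fun h' => h (coeff_eq_zero_of_size_le h')

@[simp] theorem size_zero : size (0 : SkewPolynomial D) = 0 := by simp [size]

@[simp] theorem size_eq_zero {f : SkewPolynomial D} : size f = 0 ↔ f = 0 := by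
  refine ⟨fun h => ?_, fun h => h ▸ size_zero⟩
  ext k
  simpa using coeff_eq_zero_of_size_le (h.le.trans (Nat.zero_le k))

theorem size_pos {f : SkewPolynomial D} : 0 < size f ↔ f ≠ 0 := by
  rw [Nat.pos_iff_ne_zero, Ne, size_eq_zero]

theorem coeff_size_sub_one_ne_zero {f : SkewPolynomial D} (h : f ≠ 0) :
    coeff f (size f - 1) ≠ 0 := by
  intro h0
  have hp := size_pos.2 h
  have : size f ≤ size f - 1 := by
    rw [size_le_iff]
    intro k hk
    rcases hk.eq_or_lt with rfl | hk
    · exact h0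
    · exact coeff_eq_zero_of_size_le (by omega)
  omega

theorem size_eq_of_coeff {f : SkewPolynomial D} {n : ℕ} (h : coeff f n ≠ 0)
    (h' : ∀ k, n < k → coeff f k = 0) : size f = n + 1 :=
  le_antisymm (size_le_iff.2 fun k hk => h' k hk) (lt_size_of_coeff_ne_zero h)

theorem natDegree_eq_size_sub_one (f : SkewPolynomial D) : natDegree f = size f - 1 := by
  by_cases h : f = 0
  · simp [h, natDegree]
  · refine le_antisymm (Finset.sup_le fun k hk => ?_) ?_
    · have := lt_size_of_coeff_ne_zero (mem_support_iff.1 hk)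
      simp only [id]
      omega
    · exact Finset.le_sup (f := id) (mem_support_iff.2 (coeff_size_sub_one_ne_zero h))

theorem size_le_natDegree_add_one (f : SkewPolynomial D) : size f ≤ natDegree f + 1 := by
  rw [natDegree_eq_size_sub_one]
  omega

theorem degree_le_degree_iff {f g : SkewPolynomial D} : degree g ≤ degree f ↔ size g ≤ size f := by
  have key : ∀ f : SkewPolynomial D, f ≠ 0 → degree f = ((size f - 1 : ℕ) : WithBot ℕ) := by
    intro f hf
    refine le_antisymm (Finset.max_le fun k hk => ?_) ?_
    · have := lt_size_of_coeff_ne_zero (mem_support_iff.1 hk)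
      exact WithBot.coe_le_coe.2 (by omega : k ≤ size f - 1)
    · exact Finset.le_max (mem_support_iff.2 (coeff_size_sub_one_ne_zero hf))
  by_cases hg : g = 0
  · simp [hg, degree]
  · have hg' := size_pos.2 hg
    by_cases hf : f = 0
    · rw [key g hg, hf, size_zero]
      simp only [degree, support_zero, Finset.max_empty, le_bot_iff, WithBot.natCast_ne_bot,
        false_iff]
      omega
    · have hf' := size_pos.2 hf
      rw [key f hf, key g hg, Nat.cast_le]
      omega

@[simp] theorem coeff_neg' (f : SkewPolynomial D) (k : ℕ) : coeff (-f) k = -coeff f k := by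
  simp [coeff]

@[simp] theorem coeff_sub' (f g : SkewPolynomial D) (k : ℕ) :
    coeff (f - g) k = coeff f k - coeff g k := by
  simp [coeff]

@[simp] theorem size_neg (f : SkewPolynomial D) : size (-f) = size f := by
  refine le_antisymm ?_ ?_ <;> refine size_le_iff.2 fun k hk => ?_
  · simp [coeff_eq_zero_of_size_le hk]
  · simpa using coeff_eq_zero_of_size_le hk

theorem size_add_le (f g : SkewPolynomial D) : size (f + g) ≤ max (size f) (size g) := by
  refine size_le_iff.2 fun k hk => ?_
  rw [coeff_add, coeff_eq_zero_of_size_le ((le_max_left _ _).trans hk),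
    coeff_eq_zero_of_size_le ((le_max_right _ _).trans hk), add_zero]

theorem size_sub_le (f g : SkewPolynomial D) : size (f - g) ≤ max (size f) (size g) := by
  rw [sub_eq_add_neg, ← size_neg g]
  exact size_add_le _ _

theorem size_sub_eq_right {f g : SkewPolynomial D} (h : size f < size g) :
    size (f - g) = size g := by
  refine le_antisymm ((size_sub_le _ _).trans (by omega)) ?_
  have := size_sub_le f (f - g)
  rw [sub_sub_cancel] at this
  omega

theorem size_add_eq_left {f g : SkewPolynomial D} (h : size g < size f) :
    size (f + g) = size f := by
  refine le_antisymm ((size_add_le _ _).trans (by omega)) ?_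
  have := size_sub_le (f + g) g
  rw [add_sub_cancel_right] at this
  omega

theorem size_monomial (k : ℕ) {a : D} (ha : a ≠ 0) : size (monomial k a) = k + 1 := by
  rw [size, support_monomial k ha, Finset.sup_singleton]

theorem size_C {a : D} (ha : a ≠ 0) : size (C a) = 1 := size_monomial 0 ha

@[simp] theorem size_one : size (1 : SkewPolynomial D) = 1 := size_C one_ne_zero

theorem eq_C_of_size_le_one {f : SkewPolynomial D} (h : size f ≤ 1) : f = C (coeff f 0) := by
  ext k
  rcases k with _ | k
  · simp
  · simp [coeff_eq_zero_of_size_le (h.trans (Nat.le_add_left 1 k))]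

theorem eq_sum_range_monomial (f : SkewPolynomial D) {n : ℕ} (h : size f ≤ n) :
    f = ∑ i ∈ Finset.range n, monomial i (coeff f i) := by
  conv_lhs => rw [← sum_monomial f]
  refine sum_eq_of_subset _ (by simp) fun k hk => ?_
  exact Finset.mem_range.2 ((lt_size_of_coeff_ne_zero (mem_support_iff.1 hk)).trans_le h)

theorem coeff_sum {ι : Type*} (s : Finset ι) (f : ι → SkewPolynomial D) (k : ℕ) :
    coeff (∑ i ∈ s, f i) k = ∑ i ∈ s, coeff (f i) k := by
  classical
  induction s using Finset.induction_on with
  | empty => simp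
  | insert i s hi ih => rw [Finset.sum_insert hi, Finset.sum_insert hi, coeff_add, ih]

theorem size_C_le (d : D) : size (C d) ≤ 1 := by
  by_cases h : d = 0
  · simp [h]
  · exact (size_C h).le

theorem size_X : size (X : SkewPolynomial D) = 2 := size_monomial 1 one_ne_zero

end Size

/-! ### Products, left division and principal left ideals. -/

section Mul

variable {D : Type u} [DivisionRing D] [MulSemiringAction (Multiplicative ℕ) D]

open SkewPolynomial

theorem isUnit_of_size_eq_one {f : SkewPolynomial D} (h : size f = 1) : IsUnit f := by
  rw [eq_C_of_size_le_one h.le]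
  refine (IsUnit.mk0 (coeff f 0) fun h0 => ?_).map (CRingHom (R := D))
  have := eq_C_of_size_le_one h.le
  rw [h0, C_0] at this
  rw [this, size_zero] at h
  omega

theorem coeff_monomial_mul (n : ℕ) (a : D) (g : SkewPolynomial D) (k : ℕ) :
    coeff (monomial n a * g) k = if n ≤ k then a * φ^[n] (coeff g (k - n)) else 0 := by
  induction g using SkewPolynomial.induction with
  | h0 => simp
  | ha j r q _ _ ih =>
    rw [mul_add, coeff_add, ih, monomial_mul_monomial, coeff_monomial, coeff_add, coeff_monomial]
    by_cases h : n ≤ k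
    · by_cases h2 : n + j = k
      · have : j = k - n := by omega
        simp [h, this, mul_add]
      · have : j ≠ k - n := by omega
        simp [h, h2, this]
    · have : n + j ≠ k := by omega
      simp [h, this]

theorem coeff_mul' (f g : SkewPolynomial D) (k : ℕ) :
    coeff (f * g) k =
      ∑ i ∈ Finset.range (size f),
        if i ≤ k then coeff f i * φ^[i] (coeff g (k - i)) else 0 := by
  conv_lhs => rw [eq_sum_range_monomial f le_rfl]
  simp only [Finset.sum_mul, coeff_sum, coeff_monomial_mul]

theorem φ_iterate_zero (n : ℕ) : φ^[n] (0 : D) = 0 := iterate_map_zero _ n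

theorem φ_iterate_eq_zero {n : ℕ} {a : D} : φ^[n] a = 0 ↔ a = 0 := by
  exact ((RingHom.injective (φ : D →+* D)).iterate n).eq_iff' (φ_iterate_zero n)

theorem size_mul {f g : SkewPolynomial D} (hf : f ≠ 0) (hg : g ≠ 0) :
    size (f * g) = size f + size g - 1 := by
  have hf' := size_pos.2 hf
  have hg' := size_pos.2 hg
  rw [show size f + size g - 1 = (size f + size g - 2) + 1 by omega]
  refine size_eq_of_coeff ?_ fun k hk => ?_
  · rw [coeff_mul', Finset.sum_eq_single (size f - 1)]
    · rw [if_pos (by omega), show size f + size g - 2 - (size f - 1) = size g - 1 by omega]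
      exact mul_ne_zero (coeff_size_sub_one_ne_zero hf)
        (fun h => coeff_size_sub_one_ne_zero hg (φ_iterate_eq_zero.1 h))
    · intro i hi hne
      rw [Finset.mem_range] at hi
      rw [if_pos (by omega), coeff_eq_zero_of_size_le (f := g) (by omega), φ_iterate_zero, mul_zero]
    · intro h
      exact absurd (Finset.mem_range.2 (by omega)) h
  · rw [coeff_mul']
    refine Finset.sum_eq_zero fun i hi => ?_
    rw [Finset.mem_range] at hi
    rw [if_pos (by omega), coeff_eq_zero_of_size_le (f := g) (by omega), φ_iterate_zero, mul_zero]

instance : NoZeroDivisors (SkewPolynomial D) where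
  eq_zero_or_eq_zero_of_mul_eq_zero {f g} h := by
    by_contra! hne
    have := size_mul hne.1 hne.2
    have hf := size_pos.2 hne.1
    have hg := size_pos.2 hne.2
    rw [h, size_zero] at this
    omega

theorem size_mul_le (f g : SkewPolynomial D) : size (f * g) ≤ size f + size g - 1 := by
  by_cases hf : f = 0
  · simp [hf]
  by_cases hg : g = 0
  · simp [hg]
  exact (size_mul hf hg).le

theorem size_le_size_mul_left {f g : SkewPolynomial D} (hf : f ≠ 0) : size g ≤ size (f * g) := by
  by_cases hg : g = 0
  · simp [hg]
  · have := size_pos.2 hf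
    rw [size_mul hf hg]
    omega

/-- One step of left division lowers the degree of the remainder. -/
theorem size_sub_monomial_mul_lt {f g : SkewPolynomial D} (hg : g ≠ 0) (h : size g ≤ size f) :
    size (f - monomial (natDegree f - natDegree g)
      (lc f * φ^[natDegree f - natDegree g] (lc g)⁻¹) * g) < size f := by
  have hg' := size_pos.2 hg
  suffices size (f - monomial (natDegree f - natDegree g)
      (lc f * φ^[natDegree f - natDegree g] (lc g)⁻¹) * g) ≤ size f - 1 by omega
  refine size_le_iff.2 fun k hk => ?_
  simp only [natDegree_eq_size_sub_one, lc]
  rw [coeff_sub', coeff_monomial_mul, if_pos (by omega)]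
  rcases hk.eq_or_lt with rfl | hk
  · rw [show size f - 1 - (size f - 1 - (size g - 1)) = size g - 1 by omega, mul_assoc,
      φ_iterate_apply, φ_iterate_apply, ← smul_mul',
      inv_mul_cancel₀ (coeff_size_sub_one_ne_zero hg), smul_one, mul_one, sub_self]
  · rw [coeff_eq_zero_of_size_le (f := f) (k := k) (by omega),
      coeff_eq_zero_of_size_le (f := g) (k := k - _) (by omega), φ_iterate_zero, mul_zero, sub_zero]

/-- Division as a purely algebraic fact, for the structure theory; the program `leftDiv` is treated
separately with its cost. -/
theorem exists_left_div {g : SkewPolynomial D} (hg : g ≠ 0) (f : SkewPolynomial D) :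
    ∃ c r, f = c * g + r ∧ size r < size g := by
  induction hn : size f using Nat.strong_induction_on generalizing f with
  | _ n ih =>
    subst hn
    by_cases h : size f < size g
    · exact ⟨0, f, by simp, h⟩
    · obtain ⟨c, r, h1, h2⟩ := ih _ (size_sub_monomial_mul_lt hg (not_lt.1 h)) _ rfl
      exact ⟨_ + c, r, by rw [add_mul, add_assoc, ← h1, add_sub_cancel], h2⟩

/-- Every left ideal of the skew polynomial ring is principal. -/
theorem exists_eq_span_singleton (J : Ideal (SkewPolynomial D)) : ∃ g, J = Ideal.span {g} := by
  by_cases hJ : J = ⊥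
  · exact ⟨0, by simp [hJ]⟩
  obtain ⟨x, hx, hx0⟩ := Submodule.exists_mem_ne_zero_of_ne_bot hJ
  have hne : {g | g ∈ J ∧ g ≠ 0}.Nonempty := ⟨x, hx, hx0⟩
  obtain ⟨g, ⟨hg, hg0⟩, hmin⟩ := WellFounded.has_min (measure (size (D := D))).wf _ hne
  refine ⟨g, le_antisymm (fun f hf => ?_) ((Ideal.span_singleton_le_iff_mem _).2 hg)⟩
  obtain ⟨c, r, h1, h2⟩ := exists_left_div hg0 f
  have hr : r ∈ J := by
    rw [← add_sub_cancel_left (c * g) r, ← h1]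
    exact J.sub_mem hf (J.mul_mem_left c hg)
  have : r = 0 := by
    by_contra hr0
    exact hmin r ⟨hr, hr0⟩ h2
  rw [h1, this, add_zero]
  exact Ideal.mem_span_singleton'.2 ⟨c, rfl⟩

/-- Quotient degrees in left division. -/
theorem size_quotient {f g c r : SkewPolynomial D} (hg : g ≠ 0) (h : f = c * g + r)
    (hr : size r < size g) : size c = size f + 1 - size g := by
  have hg' := size_pos.2 hg
  by_cases hc : c = 0
  · rw [hc, zero_mul, zero_add] at h
    rw [hc, size_zero, h]
    omega
  · have h1 := size_mul hc hg
    have hc' := size_pos.2 hc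
    have h2 : size f = size (c * g) := by
      rw [h]
      exact size_add_eq_left (by omega)
    omega

end Mul

/-! ### Rules for computations -/

/-- The computation `x` halts, returns `a`, and uses at most `b` basic operations. -/
def HaltsWithin {α : Type u} (x : Comp α) (a : α) (b : ℝ) : Prop :=
  ∃ c : ℕ, Halts x a c ∧ (c : ℝ) ≤ b

section Rules

variable {α β : Type u}

theorem HaltsWithin.mono {x : Comp α} {a : α} {b b' : ℝ} (h : HaltsWithin x a b) (hb : b ≤ b') :
    HaltsWithin x a b' := by
  obtain ⟨c, h1, h2⟩ := h
  exact ⟨c, h1, h2.trans hb⟩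

theorem haltsWithin_charge {c : ℕ} {a : α} {b : ℝ} (h : (c : ℝ) ≤ b) :
    HaltsWithin (charge c a) a b :=
  ⟨c, Part.mem_some _, h⟩

theorem haltsWithin_pure (a : α) : HaltsWithin (pure a : Comp α) a 0 :=
  haltsWithin_charge (by simp)

theorem HaltsWithin.bind {x : Comp α} {k : α → Comp β} {a : α} {a' : β} {b b' : ℝ}
    (h : HaltsWithin x a b) (h' : HaltsWithin (k a) a' b') :
    HaltsWithin (x >>= k) a' (b + b') := by
  obtain ⟨c, h1, h2⟩ := h
  obtain ⟨c', h1', h2'⟩ := h'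
  refine ⟨c + c', ?_, by push_cast; linarith⟩
  exact Part.mem_bind h1 (Part.mem_map (fun q => (q.1, c + q.2)) h1')

theorem HaltsWithin.bind_pure {x : Comp α} {f : α → β} {a : α} {b : ℝ} (h : HaltsWithin x a b) :
    HaltsWithin (x >>= fun a => pure (f a)) (f a) b :=
  (h.bind (k := fun a => pure (f a)) (haltsWithin_pure _)).mono (by simp)

theorem haltsWithin_mapM {ι : Type} {l : List ι} {f : ι → Comp α} {F : ι → α} {B : ι → ℝ}
    (h : ∀ i ∈ l, HaltsWithin (f i) (F i) (B i)) :
    HaltsWithin (l.mapM f) (l.map F) (l.map B).sum := by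
  -- `List.mapM` runs through an accumulator that stores the results in reverse order, so the
  -- induction needs it arbitrary.
  suffices ∀ acc, HaltsWithin (List.mapM.loop f l acc) (acc.reverse ++ l.map F) (l.map B).sum by
    exact this []
  induction l with
  | nil =>
    intro acc
    simpa [List.mapM.loop] using haltsWithin_pure acc.reverse
  | cons i l ih =>
    intro acc
    have h1 := h i (by simp)
    have h2 := ih (fun j hj => h j (by simp [hj])) (F i :: acc)
    have h3 := h1.bind (k := fun y => List.mapM.loop f l (y :: acc)) h2
    simpa [List.mapM.loop] using h3

theorem haltsWithin_foldlM {f : β → α → Comp β} {F : β → α → β} {b : ℝ}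
    (h : ∀ x y, HaltsWithin (f x y) (F x y) b) (l : List α) (x : β) :
    HaltsWithin (l.foldlM f x) (l.foldl F x) (l.length * b) := by
  induction l generalizing x with
  | nil => simpa using haltsWithin_pure x
  | cons y l ih =>
    refine ((h x y).bind (k := fun z => l.foldlM f z) (ih _)).mono ?_
    simp only [List.length_cons, Nat.cast_add, Nat.cast_one]
    linarith

end Rules

/-! ### Total correctness and cost of loops. -/

section While

variable {τ : Type u} {cond : τ → Prop} {body : τ → Comp τ}

/-- The loop never reads its counter, so a shift of the initial count shifts the final one. This
allows the tail of a run, which starts from a nonzero count, to be treated as a loop started from 0.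
-/
theorem mem_whileStep_fix_add {p q : τ × ℕ} (h : q ∈ (whileStep cond body).fix p) (k : ℕ) :
    (q.1, k + q.2) ∈ (whileStep cond body).fix (p.1, k + p.2) := by
  refine PFun.fixInduction h (C := fun p => (q.1, k + q.2) ∈ (whileStep cond body).fix (p.1, k + p.2))
    fun p hp ih => ?_
  rw [PFun.mem_fix_iff] at hp ⊢
  by_cases hc : cond p.1
  · simp only [whileStep, if_pos hc] at hp ih ⊢
    rcases hp with hp | ⟨p', hp', -⟩
    · obtain ⟨x, -, hx⟩ := (Part.mem_map_iff _).1 hp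
      cases hx
    · obtain ⟨x, hx1, hx2⟩ := (Part.mem_map_iff _).1 hp'
      cases hx2
      refine Or.inr ⟨(x.1, k + (p.2 + x.2)), ?_, ih _ hp'⟩
      rw [← add_assoc]
      exact Part.mem_map (fun q : τ × ℕ => Sum.inr (q.1, k + p.2 + q.2)) hx1
  · simp only [whileStep, if_neg hc] at hp ⊢
    rcases hp with hp | ⟨p', hp', -⟩
    · left
      have := Part.mem_some_iff.1 hp
      cases this
      exact Part.mem_some _
    · have := Part.mem_some_iff.1 hp'
      cases this

theorem haltsWithin_whileLoop_of_not {st : τ} (h : ¬ cond st) :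
    HaltsWithin (whileLoop cond body st) st 0 := by
  refine ⟨0, ?_, by simp⟩
  refine PFun.mem_fix_iff.2 (Or.inl ?_)
  simp only [whileStep, if_neg h]
  exact Part.mem_some _

theorem HaltsWithin.whileLoop_step {st st' fin : τ} {b b' : ℝ} (h : cond st)
    (h1 : HaltsWithin (body st) st' b) (h2 : HaltsWithin (whileLoop cond body st') fin b') :
    HaltsWithin (whileLoop cond body st) fin (b + b') := by
  obtain ⟨c, h1, hc⟩ := h1
  obtain ⟨c', h2, hc'⟩ := h2
  refine ⟨c + c', ?_, by push_cast; linarith⟩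
  refine PFun.mem_fix_iff.2 (Or.inr ⟨(st', 0 + c), ?_, ?_⟩)
  · simp only [whileStep, if_pos h]
    exact Part.mem_map (fun q : τ × ℕ => Sum.inr (q.1, 0 + q.2)) h1
  · simpa using mem_whileStep_fix_add h2 c

/-- Total correctness of the `while` loop, with an invariant, a variant, and a potential that
pays for the basic operations. -/
theorem haltsWithin_whileLoop (Inv : τ → Prop) (variant : τ → ℕ) (Φ : τ → ℝ)
    (step : ∀ st, Inv st → cond st → ∃ st', HaltsWithin (body st) st' (Φ st - Φ st') ∧
      Inv st' ∧ variant st' < variant st)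
    (start : τ) (h : Inv start) :
    ∃ fin, HaltsWithin (whileLoop cond body start) fin (Φ start - Φ fin) ∧ Inv fin ∧
      ¬ cond fin := by
  induction hn : variant start using Nat.strong_induction_on generalizing start with
  | _ n ih =>
    subst hn
    by_cases hc : cond start
    · obtain ⟨st', h1, h2, h3⟩ := step start h hc
      obtain ⟨fin, h4, h5, h6⟩ := ih _ h3 st' h2 rfl
      exact ⟨fin, (h1.whileLoop_step hc h4).mono (by linarith), h5, h6⟩
    · exact ⟨start, (haltsWithin_whileLoop_of_not hc).mono (by simp), h, hc⟩

end While

open SkewPolynomial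

/-! ### Cost of the elementary algorithms -/

section Cost

variable {D : Type u} [DivisionRing D]

theorem ArithCost.BoundedBy.nonneg {κ : ArithCost D} {S M I A : ℝ} (h : κ.BoundedBy S M I A) :
    0 ≤ S ∧ 0 ≤ M ∧ 0 ≤ I ∧ 0 ≤ A :=
  ⟨(Nat.cast_nonneg _).trans (h.add_le 0 0), (Nat.cast_nonneg _).trans (h.mul_le 0 0),
    (Nat.cast_nonneg _).trans (h.inv_le 0), (Nat.cast_nonneg _).trans (h.pow_le 0 0)⟩

theorem coeff_ofCoeffs (l : List D) (k : ℕ) : coeff (ofCoeffs l) k = l.getD k 0 := by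
  rw [ofCoeffs, coeff_sum]
  simp only [coeff_monomial]
  rw [Finset.sum_ite_eq']
  split_ifs with h
  · rfl
  · rw [Finset.mem_range, not_lt] at h
    rw [List.getD_eq_default _ _ h]

theorem ofCoeffs_map_range {n : ℕ} {F : ℕ → D} {p : SkewPolynomial D}
    (h : ∀ k < n, F k = coeff p k) (hn : size p ≤ n) : ofCoeffs ((List.range n).map F) = p := by
  ext k
  rw [coeff_ofCoeffs]
  by_cases hk : k < n
  · rw [List.getD_eq_getElem _ _ (by simpa using hk)]
    simpa using h k hk
  · rw [List.getD_eq_default _ _ (by simpa using hk), coeff_eq_zero_of_size_le (by omega)]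

theorem haltsWithin_sumD {κ : ArithCost D} {S M I A : ℝ} (h : κ.BoundedBy S M I A) (l : List D) :
    HaltsWithin (sumD κ l) l.sum (l.length * S) := by
  have hS := h.nonneg.1
  cases l with
  | nil => simpa [sumD] using haltsWithin_pure (0 : D)
  | cons a l =>
    have := haltsWithin_foldlM (f := addD κ) (F := (· + ·)) (b := S)
      (fun x y => haltsWithin_charge (h.add_le x y)) l a
    rw [List.sum_eq_foldl, List.foldl_cons, zero_add]
    refine this.mono ?_
    simp only [List.length_cons, Nat.cast_add, Nat.cast_one]
    linarith

theorem haltsWithin_polySub {κ : ArithCost D} {S M I A : ℝ} (h : κ.BoundedBy S M I A)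
    (f g : SkewPolynomial D) :
    HaltsWithin (polySub κ f g) (f - g) ((max (size f) (size g) : ℕ) * S) := by
  have h1 := haltsWithin_mapM (l := List.range (max (size f) (size g)))
    (f := fun k => subD κ (coeff f k) (coeff g k)) (F := fun k => coeff f k - coeff g k)
    (B := fun _ => S) fun k _ => haltsWithin_charge (h.sub_le _ _)
  have h2 := h1.bind_pure (f := ofCoeffs)
  rw [ofCoeffs_map_range (p := f - g) (by simp) (size_sub_le f g)] at h2
  refine h2.mono ?_
  simp

variable [MulSemiringAction (Multiplicative ℕ) D]

theorem haltsWithin_powD {κ : ArithCost D} {S M I A : ℝ} (h : κ.BoundedBy S M I A) (i : ℕ)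
    (a : D) : HaltsWithin (powD κ i a) (φ^[i] a) A := by
  rw [powD]
  split_ifs with hi
  · rw [hi]
    exact (haltsWithin_pure a).mono h.nonneg.2.2.2
  · exact haltsWithin_charge (h.pow_le i a)

theorem haltsWithin_powD_mulD {κ : ArithCost D} {S M I A : ℝ} (h : κ.BoundedBy S M I A) (i : ℕ)
    (a b : D) :
    HaltsWithin (powD κ i b >>= fun c => mulD κ a c) (a * φ^[i] b) (M + A) :=
  ((haltsWithin_powD h i b).bind (k := fun c => mulD κ a c)
    (haltsWithin_charge (h.mul_le _ _))).mono (add_comm A M).le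

theorem haltsWithin_monomialMul {κ : ArithCost D} {S M I A : ℝ} (h : κ.BoundedBy S M I A)
    (a : D) (k : ℕ) (g : SkewPolynomial D) :
    HaltsWithin (monomialMul κ a k g) (monomial k a * g) (size g * (M + A)) := by
  have h1 := haltsWithin_mapM (l := List.range (size g))
    (f := fun j => powD κ k (coeff g j) >>= fun b => mulD κ a b)
    (F := fun j => a * φ^[k] (coeff g j))
    (B := fun _ => M + A) fun j _ => haltsWithin_powD_mulD h k a _
  have h2 := h1.bind_pure (f := fun cs => ofCoeffs (List.replicate k 0 ++ cs))
  have h3 : ofCoeffs (List.replicate k 0 ++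
      (List.range (size g)).map fun j => a * φ^[k] (coeff g j)) = monomial k a * g := by
    ext i
    rw [coeff_ofCoeffs, coeff_monomial_mul]
    split_ifs with hi
    · rw [List.getD_append_right _ _ _ _ (by simpa using hi), List.length_replicate]
      by_cases hk : i - k < size g
      · rw [List.getD_eq_getElem _ _ (by simpa using hk)]
        simp
      · rw [List.getD_eq_default _ _ (by simpa using hk), coeff_eq_zero_of_size_le (not_lt.1 hk),
          φ_iterate_zero, mul_zero]
    · rw [List.getD_append _ _ _ _ (by simpa using hi)]
      simp
  rw [h3] at h2
  refine h2.mono ?_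
  simp [mul_add]

/-- The number of terms in one coefficient of a product; the bound by the second size holds because
i ↦ k - i is injective on the selected indices. -/
theorem length_filter_conv_le (a b k : ℕ) :
    ((List.range a).filter fun i => i ≤ k ∧ k - i < b).length ≤ min a b := by
  refine le_min ((List.length_filter_le _ _).trans (by simp)) ?_
  have : ((List.range a).filter fun i => i ≤ k ∧ k - i < b).length =
      ((Finset.range a).filter fun i => i ≤ k ∧ k - i < b).card := rfl
  rw [this, ← Finset.card_range b]
  refine Finset.card_le_card_of_injOn (fun i => k - i) ?_ ?_
  · intro i hi
    simp only [Finset.coe_filter, Set.mem_ofPred_eq] at hi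
    simpa using hi.2.2
  · intro i hi j hj hij
    simp only [Finset.coe_filter, Set.mem_ofPred_eq] at hi hj
    simp only at hij
    omega

theorem haltsWithin_polyMul {κ : ArithCost D} {S M I A : ℝ} (h : κ.BoundedBy S M I A)
    (f g : SkewPolynomial D) :
    HaltsWithin (polyMul κ f g) (f * g) (2 * (size f * size g) * (M + A + S)) := by
  obtain ⟨hS, hM, -, hA⟩ := h.nonneg
  have h1 := haltsWithin_mapM (l := List.range (size f + size g - 1))
    (f := fun k => ((List.range (size f)).filter fun i => i ≤ k ∧ k - i < size g).mapM
      (fun i => powD κ i (coeff g (k - i)) >>= fun b => mulD κ (coeff f i) b) >>= fun t => sumD κ t)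
    (F := fun k => (((List.range (size f)).filter fun i => i ≤ k ∧ k - i < size g).map
      fun i => coeff f i * φ^[i] (coeff g (k - i))).sum)
    (B := fun _ => (min (size f) (size g) : ℕ) * (M + A + S)) ?_
  · have h2 := h1.bind_pure (f := ofCoeffs)
    rw [ofCoeffs_map_range (p := f * g) ?_ (size_mul_le f g)] at h2
    · refine h2.mono ?_
      simp only [List.map_const', List.length_range, List.sum_replicate, nsmul_eq_mul]
      rw [← mul_assoc]
      refine mul_le_mul_of_nonneg_right ?_ (by positivity)
      -- Number of coefficients times terms per coefficient: a + b - 1 ≤ 2 max(a, b), and max times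
      -- min is the product.
      have : (size f + size g - 1) * min (size f) (size g) ≤ 2 * (size f * size g) := by
        rcases le_total (size f) (size g) with hl | hl
        · rw [min_eq_left hl, two_mul, ← mul_add, mul_comm]
          exact Nat.mul_le_mul_left _ (by omega)
        · rw [min_eq_right hl, two_mul, ← add_mul]
          exact Nat.mul_le_mul_right _ (by omega)
      exact_mod_cast this
    · intro k _
      rw [coeff_mul', ← Finset.sum_filter]
      have : (((List.range (size f)).filter fun i => i ≤ k ∧ k - i < size g).map
          fun i => coeff f i * φ^[i] (coeff g (k - i))).sum =
          ∑ i ∈ (Finset.range (size f)).filter (fun i => i ≤ k ∧ k - i < size g),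
            coeff f i * φ^[i] (coeff g (k - i)) := rfl
      rw [this]
      refine Finset.sum_subset (fun i hi => ?_) fun i hi hi' => ?_
      · rw [Finset.mem_filter] at hi ⊢
        exact ⟨hi.1, hi.2.1⟩
      · rw [Finset.mem_filter] at hi hi'
        have : size g ≤ k - i := by
          by_contra hlt
          exact hi' ⟨hi.1, hi.2, not_le.1 hlt⟩
        rw [coeff_eq_zero_of_size_le this, φ_iterate_zero, mul_zero]
  · intro k _
    have h2 := haltsWithin_mapM
      (l := (List.range (size f)).filter fun i => i ≤ k ∧ k - i < size g)
      (f := fun i => powD κ i (coeff g (k - i)) >>= fun b => mulD κ (coeff f i) b)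
      (F := fun i => coeff f i * φ^[i] (coeff g (k - i)))
      (B := fun _ => M + A) fun i _ => haltsWithin_powD_mulD h i _ _
    refine (h2.bind (haltsWithin_sumD h _)).mono ?_
    simp only [List.map_const', List.sum_replicate, nsmul_eq_mul, List.length_map]
    rw [← mul_add]
    exact mul_le_mul_of_nonneg_right (by exact_mod_cast length_filter_conv_le _ _ _)
      (by positivity)

/-- Correctness and cost of left division. -/
theorem exists_haltsWithin_leftDiv {κ : ArithCost D} {S M I A : ℝ} (h : κ.BoundedBy S M I A)
    (f : SkewPolynomial D) {g : SkewPolynomial D} (hg : g ≠ 0) :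
    ∃ c r, HaltsWithin (leftDiv κ f g) (c, r)
      (I + ((size f + 1 - size g : ℕ) : ℝ) * ((size g + 1) * (M + A) + (size f + 1) * S)) ∧
      f = c * g + r ∧ size r < size g := by
  obtain ⟨hS, hM, -, hA⟩ := h.nonneg
  set K : ℝ := (size g + 1) * (M + A) + (size f + 1) * S with hK
  have hK0 : 0 ≤ K := by positivity
  have hg' := size_pos.2 hg
  have key := haltsWithin_whileLoop
    (cond := fun st : SkewPolynomial D × SkewPolynomial D => degree g ≤ degree st.2)
    (body := fun st => do
      let k := natDegree st.2 - natDegree g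
      let t ← powD κ k (lc g)⁻¹
      let a ← mulD κ (lc st.2) t
      let e ← addD κ (SkewPolynomial.coeff st.1 k) a
      let p ← monomialMul κ a k g
      let r ← polySub κ st.2 p
      pure (SkewPolynomial.update st.1 k e, r))
    (fun st => f = st.1 * g + st.2 ∧ size st.2 ≤ size f) (fun st => size st.2)
    -- The potential counts the steps that may remain. Truncated subtraction makes it 0 once the
    -- remainder is shorter than `g`.
    (fun st => ((size st.2 + 1 - size g : ℕ) : ℝ) * K) ?_ (0, f) (by simp)
  · obtain ⟨⟨c, r⟩, h1, ⟨h2, -⟩, h3⟩ := key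
    refine ⟨c, r, ?_, h2, ?_⟩
    · have h4 := (haltsWithin_charge (h.inv_le (lc g))).bind
        (k := fun b => whileLoop (fun st : SkewPolynomial D × SkewPolynomial D =>
          degree g ≤ degree st.2) (fun st => do
          let k := natDegree st.2 - natDegree g
          let t ← powD κ k b
          let a ← mulD κ (lc st.2) t
          let e ← addD κ (SkewPolynomial.coeff st.1 k) a
          let p ← monomialMul κ a k g
          let r ← polySub κ st.2 p
          pure (SkewPolynomial.update st.1 k e, r)) (0, f)) h1
      refine h4.mono ?_
      have : 0 ≤ ((size r + 1 - size g : ℕ) : ℝ) * K := by positivity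
      simp only
      linarith
    · rw [degree_le_degree_iff, not_le] at h3
      exact h3
  · rintro ⟨c, r⟩ ⟨hf, hr⟩ hc
    simp only at hf hr hc ⊢
    rw [degree_le_degree_iff] at hc
    have hlt := size_sub_monomial_mul_lt hg hc
    have hrk : natDegree r - natDegree g + 1 + size g - 1 = size r := by
      rw [natDegree_eq_size_sub_one, natDegree_eq_size_sub_one]
      omega
    set k := natDegree r - natDegree g
    set a := lc r * φ^[k] (lc g)⁻¹
    have hsz : size (monomial k a * g) ≤ size r := by
      refine (size_mul_le _ _).trans ?_
      have : size (monomial k a) ≤ k + 1 := by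
        by_cases ha : a = 0
        · simp [ha]
        · exact (size_monomial k ha).le
      omega
    refine ⟨(c + monomial k a, r - monomial k a * g), ?_, ⟨?_, hlt.le.trans hr⟩, hlt⟩
    · have hupd : SkewPolynomial.update c k (coeff c k + a) = c + monomial k a := by
        ext i
        rw [coeff_update, Function.update_apply, coeff_add, coeff_monomial]
        split_ifs with h1 h2 h2
        · rw [h1]
        · exact absurd h1.symm h2
        · exact absurd h2.symm h1
        · rw [add_zero]
      rw [← hupd]
      refine HaltsWithin.mono (b := A + (M + (S + (size g * (M + A) +
        ((max (size r) (size (monomial k a * g)) : ℕ) * S + 0))))) ?_ ?_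
      · exact (haltsWithin_powD h _ _).bind ((haltsWithin_charge (h.mul_le _ _)).bind
          ((haltsWithin_charge (h.add_le _ _)).bind ((haltsWithin_monomialMul h _ _ _).bind
          ((haltsWithin_polySub h _ _).bind (haltsWithin_pure _)))))
      · rw [max_eq_left hsz]
        have h5 : (size r : ℝ) * S ≤ size f * S :=
          mul_le_mul_of_nonneg_right (by exact_mod_cast hr) hS
        have h6 : (1 : ℝ) ≤ ((size r + 1 - size g : ℕ) : ℝ) -
            ((size (r - monomial k a * g) + 1 - size g : ℕ) : ℝ) := by
          have : (size (r - monomial k a * g) + 1 - size g) + 1 ≤ size r + 1 - size g := by omega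
          have : (((size (r - monomial k a * g) + 1 - size g) + 1 : ℕ) : ℝ) ≤
            ((size r + 1 - size g : ℕ) : ℝ) := by exact_mod_cast this
          push_cast at this ⊢
          linarith
        rw [← sub_mul]
        refine le_trans ?_ (mul_le_mul_of_nonneg_right h6 hK0)
        rw [one_mul, hK]
        linarith
    · rw [hf]
      simp only
      rw [add_mul]
      abel

end Cost

/-! ### The short extended Euclidean algorithm -/

section Euclid

variable {D : Type u} [DivisionRing D] [MulSemiringAction (Multiplicative ℕ) D]

/-- The left ideal of all `x` with `x * h ∈ R f` is generated by `v`. -/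
def IsAnnGen (f h v : SkewPolynomial D) : Prop :=
  ∀ x, (∃ y, x * h = y * f) ↔ ∃ z, x = z * v

/-- The algebraic invariant of the short extended Euclidean algorithm. -/
structure EuclidInv (f h : SkewPolynomial D) (st : EuclidState D) : Prop where
  ne_zero : st.f₀ ≠ 0
  span : ∃ α β, α * st.v₀ + β * st.v₁ = 1
  rem₀ : ∃ y, st.v₀ * h = st.f₀ + y * f
  rem₁ : ∃ y, st.v₁ * h = st.f₁ + y * f
  cofactors : ∃ q₀ q₁, f = q₀ * st.f₀ + q₁ * st.f₁ ∧ q₀ * st.v₀ + q₁ * st.v₁ = 0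

/-- The degree invariant of the short extended Euclidean algorithm. -/
structure EuclidSize (f : SkewPolynomial D) (st : EuclidState D) : Prop where
  size_add : size st.v₁ + size st.f₀ = size f + 1
  size_v_le : size st.v₀ ≤ size st.v₁
  size_f_lt : size st.f₁ < size st.f₀

theorem EuclidInv.start {f h c r : SkewPolynomial D} (hh : h ≠ 0) (hf : f = c * h + r) :
    EuclidInv f h { f₀ := h, f₁ := r, v₀ := 1, v₁ := -c } where
  ne_zero := hh
  span := ⟨1, 0, by simp⟩
  rem₀ := ⟨0, by simp⟩
  rem₁ := ⟨-1, by simp [hf]⟩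
  cofactors := ⟨c, 1, by simp [hf], by simp⟩

theorem EuclidInv.step {f h c r : SkewPolynomial D} {st : EuclidState D} (hst : EuclidInv f h st)
    (h₁ : st.f₁ ≠ 0) (hr : st.f₀ = c * st.f₁ + r) :
    EuclidInv f h { f₀ := st.f₁, f₁ := r, v₀ := st.v₁, v₁ := st.v₀ - c * st.v₁ } where
  ne_zero := h₁
  span := by
    obtain ⟨α, β, e⟩ := hst.span
    exact ⟨α * c + β, α, by rw [← e]; noncomm_ring⟩
  rem₀ := hst.rem₁
  rem₁ := by
    obtain ⟨y, hy⟩ := hst.rem₀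
    obtain ⟨y', hy'⟩ := hst.rem₁
    refine ⟨y - c * y', ?_⟩
    simp only
    rw [sub_mul, mul_assoc, hy, hy', hr]
    noncomm_ring
  cofactors := by
    obtain ⟨q₀, q₁, e, e'⟩ := hst.cofactors
    refine ⟨q₀ * c + q₁, q₀, ?_, ?_⟩
    · rw [e]
      simp only
      conv_lhs => rw [hr]
      noncomm_ring
    · rw [← e']
      noncomm_ring

/-- The field `cofactors` is what excludes a generator that is too large. Given x h = y f, write x =
xα v₀ + xβ v₁. Reducing modulo the remainders gives xα f₀ = z q₀ f₀, and cancelling f₀ gives xα = z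
q₀. Then xα v₀ = z q₀ v₀ = -z q₁ v₁ is a left multiple of v₁. -/
theorem EuclidInv.isAnnGen {f h : SkewPolynomial D} {st : EuclidState D}
    (hst : EuclidInv f h st) (h₁ : st.f₁ = 0) : IsAnnGen f h st.v₁ := by
  intro x
  constructor
  · rintro ⟨y, hy⟩
    obtain ⟨α, β, e⟩ := hst.span
    obtain ⟨y₀, hy₀⟩ := hst.rem₀
    obtain ⟨y₁, hy₁⟩ := hst.rem₁
    obtain ⟨q₀, q₁, e₁, e₂⟩ := hst.cofactors
    rw [h₁, mul_zero, add_zero] at e₁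
    rw [h₁, zero_add] at hy₁
    set z := y - x * α * y₀ - x * β * y₁
    have h2 : x * α * st.f₀ = z * q₀ * st.f₀ := by
      calc x * α * st.f₀ = x * α * (st.f₀ + y₀ * f) - x * α * y₀ * f := by noncomm_ring
        _ = x * α * (st.v₀ * h) - x * α * y₀ * f := by rw [hy₀]
        _ = x * (α * st.v₀ + β * st.v₁) * h - x * β * (st.v₁ * h) - x * α * y₀ * f := by
          noncomm_ring
        _ = z * f := by rw [e, hy₁, mul_one, hy]; simp only [z]; noncomm_ring
        _ = z * q₀ * st.f₀ := by rw [e₁, mul_assoc, ← e₁]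
    have h3 : x * α = z * q₀ := mul_right_cancel₀ hst.ne_zero h2
    refine ⟨x * β - z * q₁, ?_⟩
    calc x = x * (α * st.v₀ + β * st.v₁) := by rw [e, mul_one]
      _ = x * α * st.v₀ + x * β * st.v₁ := by noncomm_ring
      _ = z * (q₀ * st.v₀ + q₁ * st.v₁) + (x * β - z * q₁) * st.v₁ := by rw [h3]; noncomm_ring
      _ = _ := by rw [e₂, mul_zero, zero_add]
  · rintro ⟨z, rfl⟩
    obtain ⟨y₁, hy₁⟩ := hst.rem₁
    exact ⟨z * y₁, by rw [mul_assoc, hy₁, h₁, zero_add, mul_assoc]⟩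

theorem EuclidInv.v₁_ne_zero {f h : SkewPolynomial D} {st : EuclidState D}
    (hst : EuclidInv f h st) (hsz : EuclidSize f st) : st.v₁ ≠ 0 := by
  intro h1
  have h0 : st.v₀ = 0 := by
    have := hsz.size_v_le
    rw [h1, size_zero] at this
    exact size_eq_zero.1 (Nat.le_zero.1 this)
  obtain ⟨α, β, e⟩ := hst.span
  rw [h0, h1, mul_zero, mul_zero, add_zero] at e
  exact zero_ne_one e

/-- Since deg f₁ < deg f₀, the quotient c has positive degree, so c v₁ dominates v₀ and no
cancellation occurs in the new cofactor. -/
theorem EuclidSize.step {f h c r : SkewPolynomial D} {st : EuclidState D} (hst : EuclidInv f h st)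
    (hsz : EuclidSize f st) (h₁ : st.f₁ ≠ 0) (hr : st.f₀ = c * st.f₁ + r)
    (hr' : size r < size st.f₁) :
    size (c * st.v₁) = size f + 1 - size st.f₁ ∧
    EuclidSize f { f₀ := st.f₁, f₁ := r, v₀ := st.v₁, v₁ := st.v₀ - c * st.v₁ } := by
  have hc := size_quotient h₁ hr hr'
  have h2 := hsz.size_f_lt
  have h3 := size_pos.2 h₁
  have h4 := hsz.size_add
  have h5 := hsz.size_v_le
  have hv := hst.v₁_ne_zero hsz
  have hc0 : c ≠ 0 := size_pos.1 (by omega)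
  have hm := size_mul hc0 hv
  have hs : size (st.v₀ - c * st.v₁) = size (c * st.v₁) := size_sub_eq_right (by omega)
  refine ⟨by omega, ?_, ?_, hr'⟩ <;> simp only <;> omega

/-- One round of the Euclidean loop. -/
noncomputable def euclidBody (κ : ArithCost D) (st : EuclidState D) : Comp (EuclidState D) := do
  let cr ← leftDiv κ st.f₀ st.f₁
  let p ← polyMul κ cr.1 st.v₁
  let v ← polySub κ st.v₀ p
  pure { f₀ := st.f₁, f₁ := cr.2, v₀ := st.v₁, v₁ := v }

variable {κ : ArithCost D} {S M I A : ℝ}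

theorem exists_haltsWithin_euclidBody (hκ : κ.BoundedBy S M I A) {st : EuclidState D}
    (h₁ : st.f₁ ≠ 0) :
    ∃ c r, HaltsWithin (euclidBody κ st)
        { f₀ := st.f₁, f₁ := r, v₀ := st.v₁, v₁ := st.v₀ - c * st.v₁ }
        ((I + ((size st.f₀ + 1 - size st.f₁ : ℕ) : ℝ) *
          ((size st.f₁ + 1) * (M + A) + (size st.f₀ + 1) * S)) +
        (2 * (size c * size st.v₁) * (M + A + S) +
          (max (size st.v₀) (size (c * st.v₁)) : ℕ) * S)) ∧
      st.f₀ = c * st.f₁ + r ∧ size r < size st.f₁ := by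
  obtain ⟨c, r, h1, h2, h3⟩ := exists_haltsWithin_leftDiv hκ st.f₀ h₁
  refine ⟨c, r, ?_, h2, h3⟩
  exact (h1.bind ((haltsWithin_polyMul hκ c st.v₁).bind
    ((haltsWithin_polySub hκ st.v₀ (c * st.v₁)).bind_pure (f := fun v =>
      EuclidState.mk st.f₁ r st.v₁ v))))

/-- Each division is charged to the drop of `size st.f₀`. By `size_add` this drop equals the growth
of `v₁`, so the total can be read off from the final cofactor. -/
theorem exists_haltsWithin_euclidLoop (hκ : κ.BoundedBy S M I A) {f h : SkewPolynomial D}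
    {st : EuclidState D} (hst : EuclidInv f h st) (hsz : EuclidSize f st) :
    ∃ fin, HaltsWithin (whileLoop (fun st : EuclidState D => st.f₁ ≠ 0) (euclidBody κ) st) fin
        (((size fin.v₁ : ℝ) - size st.v₁) * (I + 10 * size f * (M + A + S))) ∧
      IsAnnGen f h fin.v₁ ∧ fin.v₁ ≠ 0 ∧ size fin.v₁ ≤ size f := by
  obtain ⟨hS, hM, hI, hA⟩ := hκ.nonneg
  set K := I + 10 * size f * (M + A + S) with hK
  have key := haltsWithin_whileLoop (cond := fun st : EuclidState D => st.f₁ ≠ 0)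
    (body := euclidBody κ) (fun st => EuclidInv f h st ∧ EuclidSize f st)
    (fun st => size st.f₁) (fun st => (size st.f₀ : ℝ) * K) ?_ st ⟨hst, hsz⟩
  · obtain ⟨fin, h1, ⟨h2, h3⟩, h4⟩ := key
    refine ⟨fin, h1.mono (le_of_eq ?_), h2.isAnnGen (not_not.1 h4), h2.v₁_ne_zero h3, ?_⟩
    · have e1 : (size st.v₁ : ℝ) + size st.f₀ = size f + 1 := by exact_mod_cast hsz.size_add
      have e2 : (size fin.v₁ : ℝ) + size fin.f₀ = size f + 1 := by exact_mod_cast h3.size_add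
      rw [← sub_mul]
      congr 1
      linarith
    · have := h3.size_add
      have := size_pos.2 h2.ne_zero
      omega
  · rintro st ⟨hst, hsz⟩ h₁
    obtain ⟨c, r, h1, h2, h3⟩ := exists_haltsWithin_euclidBody (κ := κ) hκ h₁
    obtain ⟨h4, h5⟩ := hsz.step hst h₁ h2 h3
    refine ⟨_, h1.mono ?_, ⟨hst.step h₁ h2, h5⟩, h3⟩
    have hc := size_quotient h₁ h2 h3
    have e1 := hsz.size_add
    have e2 := size_pos.2 (hst.v₁_ne_zero hsz)
    have e3 := size_pos.2 h₁
    have e4 := hsz.size_f_lt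
    have e5 := hsz.size_v_le
    obtain ⟨δ, hδ⟩ := Nat.exists_eq_add_of_lt e4
    have hmax : max (size st.v₀) (size (c * st.v₁)) ≤ size f := by omega
    rw [hc, show size st.f₀ + 1 - size st.f₁ = δ + 2 by omega]
    have r1 : (size st.f₀ : ℝ) = size st.f₁ + δ + 1 := by exact_mod_cast hδ
    have r2 : (size st.f₀ : ℝ) ≤ size f := by exact_mod_cast (by omega : size st.f₀ ≤ size f)
    have r3 : ((max (size st.v₀) (size (c * st.v₁)) : ℕ) : ℝ) ≤ size f := by exact_mod_cast hmax
    have r4 : (size st.v₁ : ℝ) ≤ size f := by exact_mod_cast (by omega : size st.v₁ ≤ size f)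
    have r5 : (1 : ℝ) ≤ size f := by exact_mod_cast (by omega : 1 ≤ size f)
    have r6 : (size st.f₁ : ℝ) + 1 ≤ size f := by exact_mod_cast (by omega : size st.f₁ + 1 ≤ size f)
    push_cast
    have hδ0 : (0 : ℝ) ≤ δ := Nat.cast_nonneg δ
    have hW : 0 ≤ M + A := by positivity
    set F : ℝ := ((size f : ℕ) : ℝ)
    have b1 : ((δ : ℝ) + 2) * ((size st.f₁ + 1) * (M + A) + (size st.f₀ + 1) * S) ≤
        (δ + 2) * (2 * F * (M + A + S)) := by
      refine mul_le_mul_of_nonneg_left ?_ (by positivity)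
      have : (size st.f₁ + 1 : ℝ) * (M + A) ≤ 2 * F * (M + A) :=
        mul_le_mul_of_nonneg_right (by linarith) hW
      have : (size st.f₀ + 1 : ℝ) * S ≤ 2 * F * S :=
        mul_le_mul_of_nonneg_right (by linarith) hS
      linarith
    have b2 : 2 * (((δ : ℝ) + 2) * size st.v₁) * (M + A + S) ≤
        2 * ((δ + 2) * F) * (M + A + S) := by gcongr
    have b3 : ((max (size st.v₀) (size (c * st.v₁)) : ℕ) : ℝ) * S ≤ F * (M + A + S) :=
      mul_le_mul r3 (by linarith) hS (by linarith)
    have b4 : (size st.f₀ : ℝ) * K - size st.f₁ * K = (δ + 1) * K := by rw [r1]; ring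
    rw [b4, hK]
    have b5 : 0 ≤ (δ : ℝ) * I := by positivity
    have b6 : 0 ≤ F * (M + A + S) := by positivity
    have b7 : 0 ≤ (δ : ℝ) * (F * (M + A + S)) := by positivity
    push_cast at b3
    linarith

theorem annihilatorGen_eq (κ : ArithCost D) (f h : SkewPolynomial D) :
    annihilatorGen κ f h = (leftDiv κ f h >>= fun cr => polySub κ 0 cr.1 >>= fun v =>
      whileLoop (fun st : EuclidState D => st.f₁ ≠ 0) (euclidBody κ)
        { f₀ := h, f₁ := cr.2, v₀ := 1, v₁ := v } >>= fun fin => pure fin.v₁) :=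
  rfl

/-- The first division is accounted for apart from the rest. For `h` of bounded degree it is the
only long one, and the remaining growth of the cofactor is bounded; for the least common multiple
the whole cost is instead proportional to `size v`. -/
theorem exists_haltsWithin_annihilatorGen_of_le (hκ : κ.BoundedBy S M I A)
    {f h : SkewPolynomial D} (hh : h ≠ 0) (hle : size h ≤ size f) :
    ∃ v, HaltsWithin (annihilatorGen κ f h) v
        (I + ((size f + 1 - size h : ℕ) : ℝ) * ((size h + 1) * (M + A) + (size f + 2) * S) +
          ((size v : ℝ) - (size f + 1 - size h : ℕ)) * (I + 10 * size f * (M + A + S))) ∧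
      IsAnnGen f h v ∧ v ≠ 0 ∧ size v ≤ size f := by
  obtain ⟨c, r, h1, h2, h3⟩ := exists_haltsWithin_leftDiv hκ f hh
  have hc := size_quotient hh h2 h3
  have hsz : EuclidSize f { f₀ := h, f₁ := r, v₀ := 1, v₁ := -c } := by
    refine ⟨?_, ?_, h3⟩
    · simp only [size_neg, hc]; omega
    · simp only [size_neg, hc, size_one]; omega
  obtain ⟨fin, h4, h5, h6, h7⟩ := exists_haltsWithin_euclidLoop hκ (EuclidInv.start hh h2) hsz
  refine ⟨fin.v₁, ?_, h5, h6, h7⟩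
  rw [annihilatorGen_eq]
  have h8 := haltsWithin_polySub hκ 0 c
  rw [zero_sub] at h8
  refine (h1.bind (h8.bind (h4.bind_pure (f := fun fin => fin.v₁)))).mono (le_of_eq ?_)
  simp only [size_zero, size_neg, hc, Nat.zero_max]
  ring

/-- Here the first quotient is 0, so the initial state has v₁ = 0 and violates `EuclidSize`. One
round that merely swaps the roles of f and h restores it, with v₀ = 0 and v₁ = 1. -/
theorem exists_haltsWithin_annihilatorGen_of_lt (hκ : κ.BoundedBy S M I A)
    {f h : SkewPolynomial D} (hf : f ≠ 0) (hlt : size f < size h) :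
    ∃ v, HaltsWithin (annihilatorGen κ f h) v
        (2 * I + ((size h + 1 - size f : ℕ) : ℝ) * ((size f + 1) * (M + A) + (size h + 1) * S) +
          S + size f * (I + 10 * size f * (M + A + S))) ∧
      IsAnnGen f h v ∧ v ≠ 0 ∧ size v ≤ size f := by
  obtain ⟨hS, hM, hI, hA⟩ := hκ.nonneg
  have hh : h ≠ 0 := size_pos.1 (by omega)
  obtain ⟨c, r, h1, h2, h3⟩ := exists_haltsWithin_leftDiv hκ f hh
  have hc : c = 0 := size_eq_zero.1 (by rw [size_quotient hh h2 h3]; omega)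
  obtain rfl : r = f := by rw [h2, hc, zero_mul, zero_add]
  have hinv := EuclidInv.start hh h2
  obtain ⟨c', r', h4, h5, h6⟩ := exists_haltsWithin_euclidBody (κ := κ) hκ
    (st := { f₀ := h, f₁ := r, v₀ := 1, v₁ := -c }) hf
  have hinv' := hinv.step hf h5
  have hsz : EuclidSize r { f₀ := r, f₁ := r', v₀ := -c, v₁ := 1 - c' * -c } := by
    refine ⟨?_, ?_, h6⟩
    · simp only [hc, neg_zero, mul_zero, sub_zero, size_one]; omega
    · simp [hc]
  obtain ⟨fin, h7, h8, h9, h10⟩ := exists_haltsWithin_euclidLoop hκ hinv' hsz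
  refine ⟨fin.v₁, ?_, h8, h9, h10⟩
  rw [annihilatorGen_eq]
  have h11 := haltsWithin_polySub hκ 0 c
  rw [zero_sub] at h11
  refine (h1.bind (h11.bind
    ((h4.whileLoop_step (cond := fun st : EuclidState D => st.f₁ ≠ 0) hf h7).bind_pure (f := fun fin => fin.v₁)))).mono ?_
  have hq : size r + 1 - size h = 0 := by omega
  simp only [hc, hq, size_zero, neg_zero, mul_zero, sub_zero, size_one, Nat.cast_zero, zero_mul,
    max_self, Nat.max_zero, Nat.cast_one]
  have : ((size fin.v₁ : ℝ) - 1) * (I + 10 * size r * (M + A + S)) ≤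
      size r * (I + 10 * size r * (M + A + S)) := by
    refine mul_le_mul_of_nonneg_right ?_ (by positivity)
    have : (size fin.v₁ : ℝ) ≤ size r := by exact_mod_cast h10
    linarith
  linarith

/-- The cost for an `h` of bounded degree. -/
theorem exists_haltsWithin_annihilatorGen (hκ : κ.BoundedBy S M I A) {f h : SkewPolynomial D}
    (hf : f ≠ 0) (hh : h ≠ 0) {m : ℕ} (hm : size h ≤ m + 1) :
    ∃ v, HaltsWithin (annihilatorGen κ f h) v
        ((m + 2) * I + 20 * (m + 1) ^ 2 * (size f * (M + A) + size f ^ 2 * S)) ∧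
      IsAnnGen f h v ∧ v ≠ 0 ∧ size v ≤ size f := by
  obtain ⟨hS, hM, hI, hA⟩ := hκ.nonneg
  have hW : 0 ≤ M + A := by positivity
  have hf' := size_pos.2 hf
  have hh' := size_pos.2 hh
  have hF : (1 : ℝ) ≤ size f := by exact_mod_cast hf'
  have hH : (size h : ℝ) ≤ m + 1 := by exact_mod_cast hm
  have hm0 : (0 : ℝ) ≤ m := Nat.cast_nonneg m
  rcases le_or_gt (size h) (size f) with hle | hlt
  · obtain ⟨v, h1, h2, h3, h4⟩ := exists_haltsWithin_annihilatorGen_of_le hκ hh hle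
    refine ⟨v, h1.mono ?_, h2, h3, h4⟩
    have hv : (size v : ℝ) ≤ size f := by exact_mod_cast h4
    rw [show size f + 1 - size h = (size f - size h) + 1 by omega]
    push_cast [Nat.cast_sub hle]
    have hH1 : (1 : ℝ) ≤ size h := by exact_mod_cast hh'
    set F : ℝ := ((size f : ℕ) : ℝ)
    set H : ℝ := ((size h : ℕ) : ℝ)
    -- The source of the quadratic term in S: every step of the long division subtracts vectors of
    -- the full length of the dividend but multiplies only by the short `h`.
    have b1 : (F - H + 1) * ((H + 1) * (M + A) + (F + 2) * S) ≤
        F * ((m + 2) * (M + A) + (3 * F) * S) := by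
      have : 0 ≤ H := by linarith
      have : 0 ≤ F := by linarith
      refine mul_le_mul (by linarith) ?_ (by positivity) (by linarith)
      refine add_le_add (mul_le_mul_of_nonneg_right (by linarith) hW)
        (mul_le_mul_of_nonneg_right (by linarith) hS)
    -- After the first division the cofactor can grow by at most `size h - 1` more.
    have b2 : (size v - (F - H + 1)) * (I + 10 * F * (M + A + S)) ≤
        (m + 1) * (I + 10 * F * (M + A + S)) :=
      mul_le_mul_of_nonneg_right (by linarith) (by positivity)
    have b3 : F * S ≤ F ^ 2 * S := mul_le_mul_of_nonneg_right (by nlinarith) hS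
    have b4 : 0 ≤ F * (M + A) := by positivity
    have b5 : 0 ≤ F ^ 2 * S := by positivity
    have b6 := mul_le_mul_of_nonneg_left b3 hm0
    have b7 := mul_nonneg hm0 b4
    have b8 := mul_nonneg hm0 b5
    have b9 := mul_nonneg hm0 b7
    have b10 := mul_nonneg hm0 b8
    linarith
  · obtain ⟨v, h1, h2, h3, h4⟩ := exists_haltsWithin_annihilatorGen_of_lt hκ hf hlt
    refine ⟨v, h1.mono ?_, h2, h3, h4⟩
    -- Now `f` itself has bounded degree, so constants depending on m absorb everything.
    have hFm : (size f : ℝ) ≤ m := by exact_mod_cast (by omega : size f ≤ m)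
    have hq : ((size h + 1 - size f : ℕ) : ℝ) ≤ m + 1 := by
      exact_mod_cast (by omega : size h + 1 - size f ≤ m + 1)
    set F : ℝ := ((size f : ℕ) : ℝ)
    set H : ℝ := ((size h : ℕ) : ℝ)
    have b1 : ((size h + 1 - size f : ℕ) : ℝ) * ((F + 1) * (M + A) + (H + 1) * S) ≤
        (m + 1) * (2 * F * (M + A) + (m + 2) * S) := by
      have : 0 ≤ H := Nat.cast_nonneg _
      refine mul_le_mul hq ?_ (by positivity) (by linarith)
      refine add_le_add (mul_le_mul_of_nonneg_right (by linarith) hW)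
        (mul_le_mul_of_nonneg_right (by linarith) hS)
    have b2 : F * (I + 10 * F * (M + A + S)) ≤ m * (I + 10 * F * (M + A + S)) :=
      mul_le_mul_of_nonneg_right hFm (by positivity)
    have b3 : F * S ≤ F ^ 2 * S := mul_le_mul_of_nonneg_right (by nlinarith) hS
    have b3' : S ≤ F ^ 2 * S := le_mul_of_one_le_left hS (by nlinarith)
    have b4 : 0 ≤ F * (M + A) := by positivity
    have b5 : 0 ≤ F ^ 2 * S := by positivity
    have b6 := mul_le_mul_of_nonneg_left b3 hm0
    have b6' := mul_le_mul_of_nonneg_left b3' hm0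
    have b6'' := mul_le_mul_of_nonneg_left b6' hm0
    have b7 := mul_nonneg hm0 b4
    have b8 := mul_nonneg hm0 b5
    have b9 := mul_nonneg hm0 b7
    have b10 := mul_nonneg hm0 b8
    linarith

theorem leftLcm_eq (κ : ArithCost D) (a g : SkewPolynomial D) :
    leftLcm κ a g = (leftDiv κ a g >>= fun cr => annihilatorGen κ g cr.2 >>= fun v =>
      polyMul κ v a) :=
  rfl

/-- The cost is stated through `size v` because deg v is the degree gained over `a`. Since `a ∉ R
g`, the reduced operand t is nonzero, and v is nonzero too, so the two single inversions are
dominated as well. -/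
theorem exists_haltsWithin_leftLcm (hκ : κ.BoundedBy S M I A) {a g : SkewPolynomial D}
    (hg : g ≠ 0) (hle : size a ≤ size g) (ha : ∀ c, a ≠ c * g) :
    ∃ v, HaltsWithin (leftLcm κ a g) (v * a)
        (2 * I + size v * (I + 14 * size g * (M + A + S))) ∧
      IsAnnGen g a v ∧ v ≠ 0 := by
  obtain ⟨hS, hM, hI, hA⟩ := hκ.nonneg
  have hW : 0 ≤ M + A := by positivity
  obtain ⟨c, t, h1, h2, h3⟩ := exists_haltsWithin_leftDiv hκ a hg
  have ht : t ≠ 0 := fun h0 => ha c (by rw [h2, h0, add_zero])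
  obtain ⟨v, h4, h5, h6, h7⟩ := exists_haltsWithin_annihilatorGen_of_le hκ ht h3.le
  refine ⟨v, ?_, ?_, h6⟩
  · rw [leftLcm_eq]
    have h8 := h4.bind (k := fun v => polyMul κ v a) (haltsWithin_polyMul hκ v a)
    have h9 := HaltsWithin.bind (a' := v * a)
      (k := fun cr => annihilatorGen κ g cr.2 >>= fun v => polyMul κ v a) h1
      (by dsimp only; exact h8)
    refine h9.mono ?_
    clear h9 h8 h4 h1
    have hq : ((size a + 1 - size g : ℕ) : ℝ) ≤ 1 := by
      exact_mod_cast (by omega : size a + 1 - size g ≤ 1)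
    have hv : (1 : ℝ) ≤ size v := by exact_mod_cast size_pos.2 h6
    have hF : (1 : ℝ) ≤ size g := by exact_mod_cast size_pos.2 hg
    have hT : (size t : ℝ) ≤ size g := by exact_mod_cast h3.le
    have hAa : (size a : ℝ) ≤ size g := by exact_mod_cast hle
    have hu : (0 : ℝ) ≤ ((size g + 1 - size t : ℕ) : ℝ) := Nat.cast_nonneg _
    set F : ℝ := ((size g : ℕ) : ℝ)
    set u : ℝ := ((size g + 1 - size t : ℕ) : ℝ)
    have b1 : ((size a + 1 - size g : ℕ) : ℝ) * ((F + 1) * (M + A) + (size a + 1) * S) ≤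
        1 * (2 * F * (M + A) + 2 * F * S) := by
      refine mul_le_mul hq ?_ (by positivity) (by linarith)
      refine add_le_add (mul_le_mul_of_nonneg_right (by linarith) hW)
        (mul_le_mul_of_nonneg_right (by linarith) hS)
    have b2 : u * ((size t + 1) * (M + A) + (F + 2) * S) ≤ u * (I + 10 * F * (M + A + S)) := by
      refine mul_le_mul_of_nonneg_left ?_ hu
      have : (size t + 1 : ℝ) * (M + A) ≤ 10 * F * (M + A) :=
        mul_le_mul_of_nonneg_right (by linarith) hW
      have : (F + 2 : ℝ) * S ≤ 10 * F * S := mul_le_mul_of_nonneg_right (by linarith) hS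
      linarith
    have b3 : 2 * (size v * size a : ℝ) * (M + A + S) ≤ 2 * (size v * F) * (M + A + S) := by gcongr
    have b4 : F * (M + A + S) ≤ size v * (F * (M + A + S)) :=
      le_mul_of_one_le_left (by positivity) hv
    linarith
  · intro x
    rw [← h5 x]
    constructor
    · rintro ⟨y, hy⟩
      refine ⟨y - x * c, ?_⟩
      rw [sub_mul, ← hy, h2]
      noncomm_ring
    · rintro ⟨y, hy⟩
      refine ⟨x * c + y, ?_⟩
      rw [add_mul, ← hy, h2]
      noncomm_ring

end Euclid

/-! ### Left ideals and the center -/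

section Structure

variable {D : Type u} [DivisionRing D] [MulSemiringAction (Multiplicative ℕ) D]

theorem mem_of_C_mem_of_X_mem {T : Subring (SkewPolynomial D)} (hC : ∀ d, C d ∈ T) (hX : X ∈ T)
    (x : SkewPolynomial D) : x ∈ T := by
  induction x using SkewPolynomial.induction with
  | h0 => exact T.zero_mem
  | ha n r q _ _ ih =>
    rw [← C_mul_X_pow_eq_monomial]
    exact T.add_mem (T.mul_mem (hC r) (T.pow_mem hX n)) ih

theorem mem_center_of_commute {z : SkewPolynomial D} (hC : ∀ d, C d * z = z * C d)
    (hX : X * z = z * X) : z ∈ Subring.center (SkewPolynomial D) := by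
  rw [Subring.mem_center_iff]
  intro x
  have := mem_of_C_mem_of_X_mem (T := Subring.centralizer {z})
    (fun d => Subring.mem_centralizer_iff.2 (by simpa using (hC d).symm))
    (Subring.mem_centralizer_iff.2 (by simpa using hX.symm)) x
  exact (Subring.mem_centralizer_iff.1 this z rfl).symm

theorem coeff_mul_C (g : SkewPolynomial D) (d : D) (k : ℕ) :
    coeff (g * C d) k = coeff g k * φ^[k] d := by
  induction g using SkewPolynomial.induction with
  | h0 => simp
  | ha j r q _ _ ih =>
    rw [add_mul, coeff_add, ih, monomial_mul_C, coeff_monomial, coeff_add, coeff_monomial]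
    split_ifs with h
    · rw [h, add_mul]
    · simp

/-- A generator of a two-sided ideal, as a left ideal, generates it also as a right ideal. -/
theorem exists_mul_eq_of_twoSided (hφ : Function.Surjective (φ : D → D)) {g : SkewPolynomial D}
    (hg : g ≠ 0) (h : ∀ x, ∃ y, g * x = y * g) (x : SkewPolynomial D) : ∃ y, x * g = g * y := by
  have hC : ∀ d : D, ∃ y, C d * g = g * y := by
    intro d
    by_cases hd : d = 0
    · exact ⟨0, by simp [hd]⟩
    have hl := coeff_size_sub_one_ne_zero hg
    set n := size g - 1
    -- The constant e is chosen so that g e and d g have the same leading coefficient. Then g e = y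
    -- g forces y to be the constant d.
    obtain ⟨e, he⟩ := (hφ.iterate n) ((coeff g n)⁻¹ * d * coeff g n)
    have he0 : e ≠ 0 := by
      rintro rfl
      rw [φ_iterate_zero] at he
      exact mul_ne_zero (mul_ne_zero (inv_ne_zero hl) hd) hl he.symm
    obtain ⟨y, hy⟩ := h (C e)
    have hCe : C e ≠ 0 := fun h => he0 (C_eq_zero.1 h)
    have hy0 : y ≠ 0 := by
      rintro rfl
      rw [zero_mul] at hy
      exact mul_ne_zero hg hCe hy
    have hsz : size y = 1 := by
      have h1 := size_mul hg hCe
      have h2 := size_mul hy0 hg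
      have h3 := size_pos.2 hg
      rw [hy, h2, size_C he0] at h1
      omega
    have hyC := eq_C_of_size_le_one hsz.le
    have hc := congrArg (fun p => coeff p n) hy
    rw [coeff_mul_C, he, hyC, ← monomial_zero_left, coeff_monomial_mul, if_pos (Nat.zero_le n),
      Nat.sub_zero, Function.iterate_zero, id, ← mul_assoc, mul_inv_cancel_left₀ hl] at hc
    exact ⟨C e, by rw [hy, hyC, mul_right_cancel₀ hl hc]⟩
  have hX : ∃ y, X * g = g * y := by
    obtain ⟨y, hy⟩ := h X
    have hX0 : (X : SkewPolynomial D) ≠ 0 := size_pos.1 (by rw [size_X]; omega)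
    have hy0 : y ≠ 0 := by
      rintro rfl
      rw [zero_mul] at hy
      exact mul_ne_zero hg hX0 hy
    have hsz : size y = 2 := by
      have h1 := size_mul hg hX0
      have h2 := size_mul hy0 hg
      have h3 := size_pos.2 hg
      rw [hy, h2, size_X] at h1
      omega
    have ha : coeff y 1 ≠ 0 := by
      have := coeff_size_sub_one_ne_zero hy0
      rwa [hsz] at this
    have hyeq : y = C (coeff y 0) + C (coeff y 1) * X := by
      conv_lhs => rw [eq_sum_range_monomial y hsz.le]
      rw [Finset.sum_range_succ, Finset.sum_range_one, monomial_zero_left, C_mul_X_eq_monomial]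
    obtain ⟨e, he⟩ := hC (coeff y 0)
    obtain ⟨e', he'⟩ := hC (coeff y 1)⁻¹
    refine ⟨e' * (X - e), ?_⟩
    -- From g X = (y₀ + y₁ X) g, the constant part is moved to the right of g by the case already
    -- settled; y₁ is removed in the same way.
    have h1 : C (coeff y 1) * X * g = g * (X - e) := by
      rw [mul_sub, hy, ← he, ← sub_mul]
      congr 1
      rw [eq_sub_iff_add_eq, add_comm]
      exact hyeq.symm
    rw [← mul_assoc, ← he', mul_assoc, ← h1, ← mul_assoc, ← mul_assoc, ← C_mul,
      inv_mul_cancel₀ ha, C_1, one_mul]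
  let T : Subring (SkewPolynomial D) :=
    { carrier := {x | ∃ y, x * g = g * y}
      mul_mem' := by
        rintro a b ⟨y, hy⟩ ⟨y', hy'⟩
        exact ⟨y * y', by rw [mul_assoc, hy', ← mul_assoc, hy, mul_assoc]⟩
      one_mem' := ⟨1, by simp⟩
      add_mem' := by
        rintro a b ⟨y, hy⟩ ⟨y', hy'⟩
        exact ⟨y + y', by rw [add_mul, hy, hy', mul_add]⟩
      zero_mem' := ⟨0, by simp⟩
      neg_mem' := by
        rintro a ⟨y, hy⟩
        exact ⟨-y, by rw [neg_mul, hy, mul_neg]⟩ }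
  exact mem_of_C_mem_of_X_mem (T := T) hC hX x

/-- Left division of central elements has central quotient and remainder. -/
theorem exists_center_div {p z : SkewPolynomial D} (hp0 : p ≠ 0)
    (hp : p ∈ Subring.center (SkewPolynomial D)) (hz : z ∈ Subring.center (SkewPolynomial D)) :
    ∃ q t, q ∈ Subring.center (SkewPolynomial D) ∧ t ∈ Subring.center (SkewPolynomial D) ∧
      z = q * p + t ∧ size t < size p := by
  obtain ⟨q, t, h1, h2⟩ := exists_left_div hp0 z
  rw [Subring.mem_center_iff] at hp hz
  -- The commutator of q with x, times p, is minus that of t with x. The latter has small degree for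
  -- x constant or x = X, which forces q to commute.
  have key : ∀ x, (x * q - q * x) * p = t * x - x * t := by
    intro x
    have h3 := hz x
    rw [h1, mul_add, add_mul] at h3
    have h4 : q * x * p = q * p * x := by rw [mul_assoc, hp x, mul_assoc]
    rw [sub_mul, h4, mul_assoc]
    rw [sub_eq_sub_iff_add_eq_add, h3, add_comm]
  have hC : ∀ d, C d * q = q * C d := by
    intro d
    by_contra hne
    have h3 := size_le_size_mul_left (g := p) (sub_ne_zero.2 hne)
    rw [key] at h3
    have h4 := size_sub_le (t * C d) (C d * t)
    have h5 := size_mul_le t (C d)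
    have h6 := size_mul_le (C d) t
    have h7 := size_C_le d
    omega
  have hX : X * q = q * X := by
    by_contra hne
    have hw := sub_ne_zero.2 hne
    have h3 := size_mul hw hp0
    rw [key] at h3
    have h4 := size_sub_le (t * X) (X * t)
    have h5 := size_mul_le t X
    have h6 := size_mul_le X t
    rw [size_X (D := D)] at h5 h6
    have h7 := eq_C_of_size_le_one (f := X * q - q * X) (by omega)
    -- Degrees only show that the commutator is constant; it vanishes because neither product has a
    -- constant term.
    have h8 : coeff (X * q - q * X) 0 = 0 := by
      rw [coeff_sub', X, coeff_monomial_mul, coeff_mul']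
      simp [coeff_monomial]
    rw [h8, C_0] at h7
    exact hw h7
  have hq := mem_center_of_commute hC hX
  refine ⟨q, t, hq, ?_, h1, h2⟩
  rw [Subring.mem_center_iff] at hq ⊢
  intro x
  have := key x
  rw [hq x, sub_self, zero_mul] at this
  exact (sub_eq_zero.1 this.symm).symm

/-- A family is linearly independent over the center if all coefficients of each linear relation
lie in a fixed proper left ideal. -/
theorem linearIndependent_of_coeff_mem {ι : Type*} [Fintype ι] {J : Ideal (SkewPolynomial D)}
    (hJ : J ≠ ⊤) (y : ι → SkewPolynomial D)
    (h : ∀ z : ι → Subring.center (SkewPolynomial D), ∑ i, z i • y i = 0 →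
      ∀ i, (z i : SkewPolynomial D) ∈ J) :
    LinearIndependent (Subring.center (SkewPolynomial D)) y := by
  rw [Fintype.linearIndependent_iff]
  intro z hz
  induction hn : ∑ i, size (z i : SkewPolynomial D) using Nat.strong_induction_on
    generalizing z with
  | _ n ih =>
    subst hn
    by_contra! hne
    obtain ⟨i₀, hi₀⟩ := hne
    -- A nonzero central p of least degree in J divides every central element of J. It is no unit
    -- since J is proper, so dividing a relation by p gives a smaller one: infinite descent.
    let P : Set (SkewPolynomial D) :=
      {p | p ∈ Subring.center (SkewPolynomial D) ∧ p ∈ J ∧ p ≠ 0}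
    have hi₀' : (z i₀ : SkewPolynomial D) ≠ 0 := fun h0 => hi₀ (Subtype.ext h0)
    have hP : P.Nonempty := ⟨z i₀, (z i₀).2, h z hz i₀, hi₀'⟩
    obtain ⟨p, ⟨hpc, hpJ, hp0⟩, hmin⟩ := WellFounded.has_min (measure (size (D := D))).wf P hP
    have hp2 : 2 ≤ size p := by
      have h1 := size_pos.2 hp0
      by_contra hlt
      exact hJ (Ideal.eq_top_of_isUnit_mem _ hpJ (isUnit_of_size_eq_one (by omega)))
    have hdiv : ∀ i, ∃ q : Subring.center (SkewPolynomial D), (z i : SkewPolynomial D) = q * p := by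
      intro i
      obtain ⟨q, t, hq, ht, h1, h2⟩ := exists_center_div hp0 hpc (z i).2
      have htJ : t ∈ J := by
        rw [← add_sub_cancel_left (q * p) t, ← h1]
        exact J.sub_mem (h z hz i) (J.mul_mem_left q hpJ)
      have ht0 : t = 0 := by
        by_contra ht0
        exact hmin t ⟨ht, htJ, ht0⟩ h2
      exact ⟨⟨q, hq⟩, by rw [h1, ht0, add_zero]⟩
    choose q hq using hdiv
    have hsum : ∑ i, q i • y i = 0 := by
      have h1 : (∑ i, q i • y i) * p = 0 := by
        rw [← hz, Finset.sum_mul]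
        refine Finset.sum_congr rfl fun i _ => ?_
        rw [Subring.smul_def, Subring.smul_def, smul_eq_mul, smul_eq_mul, hq, mul_assoc, mul_assoc,
          Subring.mem_center_iff.1 hpc]
      exact (mul_eq_zero.1 h1).resolve_right hp0
    have hle : ∀ i, size (q i : SkewPolynomial D) ≤ size (z i : SkewPolynomial D) ∧
        ((z i : SkewPolynomial D) ≠ 0 →
          size (q i : SkewPolynomial D) < size (z i : SkewPolynomial D)) := by
      intro i
      rw [hq]
      by_cases hqi : (q i : SkewPolynomial D) = 0
      · simp [hqi]
      · have := size_mul hqi hp0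
        omega
    have hlt : ∑ i, size (q i : SkewPolynomial D) < ∑ i, size (z i : SkewPolynomial D) :=
      Finset.sum_lt_sum (fun i _ => (hle i).1) ⟨i₀, Finset.mem_univ _, (hle i₀).2 hi₀'⟩
    have := ih _ hlt q hsum rfl i₀
    apply hi₀'
    rw [hq, this]
    simp

/-- The left Ore condition with a degree bound. Euclidean recursion replaces the pair (f, h) by (t,
f); if w f = y t, then y h = (y c + w) f, and comparing degrees bounds y. -/
theorem exists_mul_eq_mul {f : SkewPolynomial D} (hf : f ≠ 0) (h : SkewPolynomial D) :
    ∃ v y, v ≠ 0 ∧ size v ≤ size f ∧ v * h = y * f := by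
  induction hn : size f using Nat.strong_induction_on generalizing f h with
  | _ n ih =>
    subst hn
    obtain ⟨c, t, h1, h2⟩ := exists_left_div hf h
    by_cases ht : t = 0
    · refine ⟨1, c, one_ne_zero, ?_, by rw [h1, ht, one_mul, add_zero]⟩
      rw [size_one]
      exact size_pos.2 hf
    · obtain ⟨w, y, hw, hwt, e⟩ := ih _ h2 ht f rfl
      have hy : y ≠ 0 := by
        rintro rfl
        rw [zero_mul] at e
        exact mul_ne_zero hw hf e
      refine ⟨y, y * c + w, hy, ?_, by rw [h1, add_mul, mul_add, e, mul_assoc]⟩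
      have e1 := size_mul hw hf
      have e2 := size_mul hy ht
      have e3 := size_pos.2 ht
      rw [e, e2] at e1
      omega

/-- The vectors are killed one after another, each by a further left factor of degree at most deg f.
-/
theorem exists_smul_eq_zero {f : SkewPolynomial D} (hf : f ≠ 0)
    (s : Finset (SkewPolynomial D ⧸ Ideal.span {f})) :
    ∃ b : SkewPolynomial D, b ≠ 0 ∧ (∀ x ∈ s, b • x = 0) ∧
      size b ≤ s.card * (size f - 1) + 1 := by
  classical
  induction s using Finset.induction_on with
  | empty => exact ⟨1, one_ne_zero, by simp, by simp⟩
  | insert x s hx ih =>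
    obtain ⟨b, hb, hbs, hsz⟩ := ih
    obtain ⟨h, hh⟩ := Submodule.Quotient.mk_surjective _ (b • x)
    obtain ⟨v, y, hv, hvf, e⟩ := exists_mul_eq_mul hf h
    refine ⟨v * b, mul_ne_zero hv hb, ?_, ?_⟩
    · intro x' hx'
      rw [mul_smul]
      rcases Finset.mem_insert.1 hx' with rfl | hx'
      · rw [← hh, ← Submodule.Quotient.mk_smul, Submodule.Quotient.mk_eq_zero, smul_eq_mul, e]
        exact Ideal.mem_span_singleton'.2 ⟨y, rfl⟩
      · rw [hbs x' hx', smul_zero]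
    · have := size_pos.2 hf
      rw [Finset.card_insert_of_notMem hx, size_mul hv hb, add_mul, one_mul]
      omega

end Structure

/-! ### The degree of the bound -/

section Simple

variable {R : Type u} [Ring R]

/-- Multiplication by a central element, as an endomorphism of a module. -/
def centerEnd (V : Type u) [AddCommGroup V] [Module R V] (z : Subring.center R) :
    Module.End R V where
  toFun v := (z : R) • v
  map_add' := smul_add _
  map_smul' r v := by
    rw [RingHom.id_apply, ← mul_smul, ← mul_smul, Subring.mem_center_iff.1 z.2]

/-- Matrix units of a simple module. -/
theorem exists_matrix_units {V : Type u} [AddCommGroup V] [Module R V] [IsSimpleModule R V]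
    {ι κ : Type*} [Fintype κ] [DecidableEq κ] (B : Module.Basis ι (Module.End R V) V) (e : κ ↪ ι)
    (a b : κ) : ∃ y : R, ∀ c, y • B (e c) = if c = b then B (e a) else 0 := by
  classical
  -- The matrix unit as a linear map over the endomorphism ring; density provides a ring element
  -- acting like it on finitely many vectors.
  let F : Module.End (Module.End R V) V :=
    B.constr ℕ fun i => if i = e b then B (e a) else 0
  obtain ⟨y, hy⟩ := jacobson_density F (Finset.univ.image fun c => B (e c))
  refine ⟨y, fun c => ?_⟩
  rw [← hy _ (Finset.mem_image_of_mem _ (Finset.mem_univ c)), Module.Basis.constr_basis]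
  simp

end Simple

/-! ### An annihilating element of small degree. -/

section Bound

variable {D : Type u} [DivisionRing D] [MulSemiringAction (Multiplicative ℕ) D]

/-- Applying a relation among the matrix units to a basis vector isolates one column. Central
elements act as endomorphisms, so independence over the endomorphism ring makes each coefficient act
as 0 on R/J. Evaluated at the class of 1, this only places the coefficients in J, which is exactly
what `linearIndependent_of_coeff_mem` asks for. -/
theorem card_mul_card_le_finrank
    [Module.Finite (Subring.center (SkewPolynomial D)) (SkewPolynomial D)]
    {J : Ideal (SkewPolynomial D)} (hJ : J.IsMaximal)
    [IsSimpleModule (SkewPolynomial D) (SkewPolynomial D ⧸ J)]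
    {ι κ : Type*} [Fintype κ]
    (B : Module.Basis ι (Module.End (SkewPolynomial D) (SkewPolynomial D ⧸ J))
      (SkewPolynomial D ⧸ J)) (e : κ ↪ ι) :
    Fintype.card κ * Fintype.card κ ≤ centerRank D := by
  classical
  choose y hy using exists_matrix_units B e
  have hli : LinearIndependent (Subring.center (SkewPolynomial D))
      (fun p : κ × κ => y p.1 p.2) := by
    refine linearIndependent_of_coeff_mem hJ.ne_top _ fun z hz => ?_
    rintro ⟨a, c⟩
    have h1 := congrArg (fun w : SkewPolynomial D => w • B (e c)) hz
    simp only [Finset.sum_smul, Subring.smul_def, smul_eq_mul, mul_smul, hy, zero_smul] at h1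
    rw [Fintype.sum_prod_type] at h1
    simp only [smul_ite, smul_zero, Finset.sum_ite_eq, Finset.mem_univ, if_true] at h1
    have h2 := (Fintype.linearIndependent_iff.1 (B.linearIndependent.comp e e.injective))
      (fun a => centerEnd (SkewPolynomial D ⧸ J) (z (a, c))) h1 a
    have h3 := LinearMap.congr_fun h2 (Submodule.Quotient.mk 1)
    have h4 : ((z (a, c) : SkewPolynomial D)) • (Submodule.Quotient.mk 1 : SkewPolynomial D ⧸ J) =
      0 := h3
    rwa [← Submodule.Quotient.mk_smul, Submodule.Quotient.mk_eq_zero, smul_eq_mul, mul_one] at h4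
  have := hli.fintype_card_le_finrank
  rwa [Fintype.card_prod] at this

theorem exists_finset_annihilating
    [Module.Finite (Subring.center (SkewPolynomial D)) (SkewPolynomial D)]
    {J : Ideal (SkewPolynomial D)} (hJ : J.IsMaximal) :
    ∃ s : Finset (SkewPolynomial D ⧸ J), s.card * s.card ≤ centerRank D ∧
      ∀ b : SkewPolynomial D, (∀ x ∈ s, b • x = 0) → ∀ x : SkewPolynomial D ⧸ J, b • x = 0 := by
  classical
  have : IsSimpleModule (SkewPolynomial D) (SkewPolynomial D ⧸ J) :=
    isSimpleModule_iff_isCoatom.2 hJ.out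
  let B := Module.Basis.ofVectorSpace
    (Module.End (SkewPolynomial D) (SkewPolynomial D ⧸ J)) (SkewPolynomial D ⧸ J)
  have hfin : Finite (Module.Basis.ofVectorSpaceIndex
      (Module.End (SkewPolynomial D) (SkewPolynomial D ⧸ J)) (SkewPolynomial D ⧸ J)) := by
    by_contra hinf
    rw [not_finite_iff_infinite] at hinf
    -- An infinite basis would contain r + 1 vectors, giving (r + 1)² ≤ r.
    have := card_mul_card_le_finrank hJ B
      (κ := Fin (centerRank D + 1)) (Fin.valEmbedding.trans (Infinite.natEmbedding _))
    rw [Fintype.card_fin] at this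
    nlinarith
  have := Fintype.ofFinite (Module.Basis.ofVectorSpaceIndex
      (Module.End (SkewPolynomial D) (SkewPolynomial D ⧸ J)) (SkewPolynomial D ⧸ J))
  refine ⟨Finset.univ.image B, ?_, fun b hb x => ?_⟩
  · refine le_trans ?_ (card_mul_card_le_finrank hJ B (Function.Embedding.refl _))
    exact Nat.mul_le_mul Finset.card_image_le Finset.card_image_le
  · rw [← B.sum_repr x, Finset.smul_sum]
    refine Finset.sum_eq_zero fun i _ => ?_
    rw [Module.End.smul_def, ← map_smul, hb _ (Finset.mem_image_of_mem _ (Finset.mem_univ i)),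
      map_zero]

/-- The annihilator of `R / R f` contains a nonzero element of degree at most `√r * deg f`. -/
theorem exists_mem_annihilator_natDegree_le
    [Module.Finite (Subring.center (SkewPolynomial D)) (SkewPolynomial D)]
    {f : SkewPolynomial D} (hf : f ≠ 0) :
    ∃ b : SkewPolynomial D, b ≠ 0 ∧ (∀ x, ∃ y, b * x = y * f) ∧
      ((size b : ℝ) - 1) ≤ √(centerRank D : ℝ) * ((size f : ℝ) - 1) := by
  induction hn : size f using Nat.strong_induction_on generalizing f with
  | _ n ih =>
    subst hn
    have hf1 := size_pos.2 hf
    by_cases h1 : size f = 1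
    · obtain ⟨u, hu⟩ := isUnit_of_size_eq_one h1
      exact ⟨1, one_ne_zero, fun x => ⟨x * ((u⁻¹ : (SkewPolynomial D)ˣ) : SkewPolynomial D),
        by rw [← hu]; simp⟩, by simp [h1]⟩
    by_cases hmax : (Ideal.span {f}).IsMaximal
    · obtain ⟨s, hs, hann⟩ := exists_finset_annihilating hmax
      obtain ⟨b, hb, hbs, hsz⟩ := exists_smul_eq_zero hf s
      refine ⟨b, hb, fun x => ?_, ?_⟩
      · have h2 := hann b hbs (Submodule.Quotient.mk x)
        rw [← Submodule.Quotient.mk_smul, Submodule.Quotient.mk_eq_zero, smul_eq_mul] at h2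
        obtain ⟨y, hy⟩ := Ideal.mem_span_singleton'.1 h2
        exact ⟨y, hy.symm⟩
      · have h2 : (s.card : ℝ) ≤ √(centerRank D : ℝ) := by
          refine Real.le_sqrt_of_sq_le ?_
          rw [sq]
          exact_mod_cast hs
        have h3 : (size b : ℝ) ≤ s.card * (size f - 1) + 1 := by
          have : ((size f - 1 : ℕ) : ℝ) = size f - 1 := by push_cast [Nat.cast_sub hf1]; ring
          rw [← this]
          exact_mod_cast hsz
        have h4 : (0 : ℝ) ≤ size f - 1 := by
          have : (1 : ℝ) ≤ size f := by exact_mod_cast hf1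
          linarith
        have := mul_le_mul_of_nonneg_right h2 h4
        linarith
    · have hne : Ideal.span {f} ≠ ⊤ := by
        intro h2
        obtain ⟨y, hy⟩ := Ideal.mem_span_singleton'.1 
          (h2 ▸ Submodule.mem_top : (1 : SkewPolynomial D) ∈ Ideal.span {f})
        have hy0 : y ≠ 0 := by
          rintro rfl
          simp at hy
        have := size_mul hy0 hf
        have := size_pos.2 hy0
        rw [hy, size_one] at *
        omega
      have hex : ∃ J : Ideal (SkewPolynomial D), Ideal.span {f} < J ∧ J ≠ ⊤ := by
        by_contra! hcon
        exact hmax ⟨hne, fun J hJ => hcon J hJ⟩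
      obtain ⟨J, hlt, hJ⟩ := hex
      obtain ⟨h, rfl⟩ := exists_eq_span_singleton J
      obtain ⟨g, hg⟩ := Ideal.mem_span_singleton'.1
        ((Ideal.span_singleton_le_iff_mem _).1 hlt.le)
      have hg0 : g ≠ 0 := by
        rintro rfl
        exact hf (by rw [← hg, zero_mul])
      have hh0 : h ≠ 0 := by
        rintro rfl
        exact hf (by rw [← hg, mul_zero])
      have hs := size_mul hg0 hh0
      rw [hg] at hs
      have hg1 := size_pos.2 hg0
      have hh1 := size_pos.2 hh0
      have hgu : size g ≠ 1 := by
        intro h2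
        obtain ⟨u, hu⟩ := isUnit_of_size_eq_one h2
        refine hlt.not_ge ((Ideal.span_singleton_le_iff_mem _).2 (Ideal.mem_span_singleton'.2
          ⟨((u⁻¹ : (SkewPolynomial D)ˣ) : SkewPolynomial D), ?_⟩))
        rw [← hg, ← hu, Units.inv_mul_cancel_left]
      have hhu : size h ≠ 1 := fun h2 =>
        hJ (Ideal.eq_top_of_isUnit_mem _ (Ideal.mem_span_singleton_self h)
          (isUnit_of_size_eq_one h2))
      obtain ⟨b, hb0, hb, hbs⟩ := ih _ (by omega : size g < size f) hg0 rfl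
      obtain ⟨b', hb0', hb', hbs'⟩ := ih _ (by omega : size h < size f) hh0 rfl
      -- The order matters: b' carries R into R h, and b then carries the cofactor into R g.
      refine ⟨b * b', mul_ne_zero hb0 hb0', fun x => ?_, ?_⟩
      · obtain ⟨y, hy⟩ := hb' x
        obtain ⟨y', hy'⟩ := hb y
        exact ⟨y', by rw [mul_assoc, hy, ← mul_assoc, hy', mul_assoc, hg]⟩
      · have e1 : (size f : ℝ) + 1 = size g + size h := by
          exact_mod_cast (by omega : size f + 1 = size g + size h)
        have e2 : (size (b * b') : ℝ) + 1 = size b + size b' := by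
          have h2 := size_mul hb0 hb0'
          have := size_pos.2 hb0
          exact_mod_cast (by omega : size (b * b') + 1 = size b + size b')
        have e3 : (size f : ℝ) - 1 = (size g - 1) + (size h - 1) := by linarith
        rw [e3, mul_add]
        linarith

end Bound

/-! ### Finiteness over the center -/

section Finite

variable {D : Type u} [DivisionRing D]

/-- A skew field that is finite over its center is finite over the central elements fixed by an
automorphism of finite order. -/
theorem exists_finite_span_fixed [Module.Finite (Subring.center D) D] {σ : RingAut D}
    (hσ : IsOfFinOrder σ) :
    ∃ (n : ℕ) (s : Fin n → D), ∀ P : D → Prop, (∀ i, P (s i)) → P 0 →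
      (∀ a b, P a → P b → P (a + b)) →
      (∀ k a, k ∈ Subring.center D → σ k = k → P a → P (k * a)) → ∀ a, P a := by
  let C := Subring.center D
  let G := Subgroup.zpowers σ
  have : Finite G := finite_zpowers.2 hσ
  -- The finite group generated by σ acts on the center of D, so by Artin the center is finite over
  -- its fixed field, and D is finite over that field by transitivity.
  let _ : MulSemiringAction G C :=
    { smul := fun g c => ⟨(g : RingAut D) c, by
        rw [Subring.mem_center_iff]
        intro x
        obtain ⟨x, rfl⟩ := (g : RingAut D).surjective x
        rw [← map_mul, ← map_mul, Subring.mem_center_iff.1 c.2]⟩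
      one_smul := fun c => Subtype.ext rfl
      mul_smul := fun g h c => Subtype.ext rfl
      smul_zero := fun g => Subtype.ext (map_zero (g : RingAut D))
      smul_add := fun g a b => Subtype.ext (map_add (g : RingAut D) (a : D) b)
      smul_one := fun g => Subtype.ext (map_one (g : RingAut D))
      smul_mul := fun g a b => Subtype.ext (map_mul (g : RingAut D) (a : D) b) }
  let F := FixedPoints.subfield G C
  have : FiniteDimensional F C := inferInstance
  have : Module.Finite F D := Module.Finite.trans C D
  obtain ⟨n, s, hs⟩ := Module.Finite.exists_fin (R := F) (M := D)
  refine ⟨n, s, fun P h1 h2 h3 h4 a => ?_⟩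
  have ha : a ∈ Submodule.span F (Set.range s) := hs ▸ Submodule.mem_top
  induction ha using Submodule.span_induction with
  | mem x hx =>
    obtain ⟨i, rfl⟩ := hx
    exact h1 i
  | zero => exact h2
  | add x y _ _ hx hy => exact h3 x y hx hy
  | smul k x _ hx =>
    refine h4 ((k : C) : D) x (k : C).2 ?_ hx
    exact congrArg Subtype.val (k.2 ⟨σ, Subgroup.mem_zpowers σ⟩)

variable [MulSemiringAction (Multiplicative ℕ) D]

/-- If σ has finite order, dividing N, then X^N is central, and so are the central constants fixed
by σ. Hence the monomials s_i X^j with j < N span, where the s_i span D over those constants. -/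
theorem finite_over_center [Module.Finite (Subring.center D) D] {σ : RingAut D}
    (hσφ : ∀ a : D, σ a = φ a) (hσ : IsOfFinOrder σ) :
    Module.Finite (Subring.center (SkewPolynomial D)) (SkewPolynomial D) := by
  obtain ⟨n, s, hs⟩ := exists_finite_span_fixed hσ
  obtain ⟨N, hN, hpow⟩ := hσ.exists_pow_eq_one
  have hφN : ∀ a : D, φ^[N] a = a := by
    intro a
    have h1 : ∀ k (a : D), φ^[k] a = (σ ^ k) a := by
      intro k
      induction k with
      | zero => intro a; rfl
      | succ k ih => intro a; rw [Function.iterate_succ_apply, ih, ← hσφ, pow_succ]; rfl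
    rw [h1, hpow]
    rfl
  have hXN : ∀ q, (X : SkewPolynomial D) ^ (N * q) ∈ Subring.center (SkewPolynomial D) := by
    intro q
    rw [pow_mul]
    refine Subring.pow_mem _ (mem_center_of_commute (fun d => ?_) ?_) q
    · rw [← monomial_one_right_eq_X_pow, monomial_mul_C, hφN, one_mul, C_mul_monomial, mul_one]
    · rw [← pow_succ, ← pow_succ']
  have hC : ∀ k : D, k ∈ Subring.center D → σ k = k → C k ∈ Subring.center (SkewPolynomial D) := by
    intro k hk hk'
    refine mem_center_of_commute (fun d => ?_) ?_
    · rw [← C_mul, ← C_mul, Subring.mem_center_iff.1 hk]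
    · rw [C_mul_X_eq_monomial, X, monomial_mul_C, Function.iterate_one, ← hσφ, hk', one_mul]
  have hfin : (Set.range fun p : Fin n × Fin N => (monomial (p.2 : ℕ) (s p.1) :
      SkewPolynomial D)).Finite := Set.finite_range _
  refine ⟨⟨hfin.toFinset, eq_top_iff.2 fun x _ => ?_⟩⟩
  rw [Set.Finite.coe_toFinset]
  set W := Submodule.span (Subring.center (SkewPolynomial D))
    (Set.range fun p : Fin n × Fin N => (monomial (p.2 : ℕ) (s p.1) : SkewPolynomial D))
  have hmon : ∀ j a, monomial j a ∈ W := by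
    intro j
    refine hs (fun a => monomial j a ∈ W) (fun i => ?_) ?_ (fun a b ha hb => ?_)
      (fun k a hk hk' ha => ?_)
    · have h1 : (monomial (j % N) (s i) : SkewPolynomial D) ∈ W :=
        Submodule.subset_span ⟨(i, ⟨j % N, Nat.mod_lt _ hN⟩), rfl⟩
      have h2 := W.smul_mem ⟨_, hXN (j / N)⟩ h1
      rw [Subring.smul_def, smul_eq_mul, ← Subring.mem_center_iff.1 (hXN _),
        monomial_mul_X_pow, Nat.mod_add_div] at h2
      exact h2
    · rw [map_zero]
      exact W.zero_mem
    · rw [map_add]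
      exact W.add_mem ha hb
    · have h2 := W.smul_mem ⟨_, hC k hk hk'⟩ ha
      rwa [Subring.smul_def, smul_eq_mul, C_mul_monomial] at h2
  rw [eq_sum_range_monomial x le_rfl]
  exact Submodule.sum_mem _ fun i _ => hmon i _

end Finite

/-! ### The algorithm for the bound -/

section Bound

variable {D : Type u} [DivisionRing D] [MulSemiringAction (Multiplicative ℕ) D]

theorem mem_annihilator_quotient_iff {f b : SkewPolynomial D} :
    b ∈ Module.annihilator (SkewPolynomial D) (SkewPolynomial D ⧸ Ideal.span {f}) ↔
      ∀ x, ∃ y, b * x = y * f := by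
  rw [Module.mem_annihilator]
  constructor
  · intro h x
    have h2 := h (Submodule.Quotient.mk x)
    rw [← Submodule.Quotient.mk_smul, Submodule.Quotient.mk_eq_zero, smul_eq_mul] at h2
    obtain ⟨y, hy⟩ := Ideal.mem_span_singleton'.1 h2
    exact ⟨y, hy.symm⟩
  · intro h x
    obtain ⟨x, rfl⟩ := Submodule.Quotient.mk_surjective _ x
    obtain ⟨y, hy⟩ := h x
    rw [← Submodule.Quotient.mk_smul, Submodule.Quotient.mk_eq_zero, smul_eq_mul, hy]
    exact Ideal.mem_span_singleton'.2 ⟨y, rfl⟩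

theorem exists_annihilator_eq_span
    [Module.Finite (Subring.center (SkewPolynomial D)) (SkewPolynomial D)]
    {f : SkewPolynomial D} (hf : f ≠ 0) :
    ∃ b : SkewPolynomial D, b ≠ 0 ∧
      Module.annihilator (SkewPolynomial D) (SkewPolynomial D ⧸ Ideal.span {f}) =
        Ideal.span {b} ∧
      ((size b : ℝ) - 1) ≤ √(centerRank D : ℝ) * ((size f : ℝ) - 1) := by
  obtain ⟨b', hb0', hb', hsz⟩ := exists_mem_annihilator_natDegree_le hf
  obtain ⟨b, hb⟩ := exists_eq_span_singleton
    (Module.annihilator (SkewPolynomial D) (SkewPolynomial D ⧸ Ideal.span {f}))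
  have hmem := mem_annihilator_quotient_iff.2 hb'
  rw [hb] at hmem
  obtain ⟨c, rfl⟩ := Ideal.mem_span_singleton'.1 hmem
  refine ⟨b, right_ne_zero_of_mul hb0', hb, le_trans ?_ hsz⟩
  have : (size b : ℝ) ≤ size (c * b) := by
    exact_mod_cast size_le_size_mul_left (left_ne_zero_of_mul hb0')
  linarith

theorem eq_zero_of_eq_mul_of_size_lt {w g t : SkewPolynomial D} (h : t = w * g)
    (ht : size t < size g) : t = 0 := by
  by_contra h0
  have hw : w ≠ 0 := by
    rintro rfl
    exact h0 (by rw [h, zero_mul])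
  have := size_le_size_mul_left (g := g) hw
  rw [← h] at this
  omega

theorem exists_eq_mul_of_size_le {w g a : SkewPolynomial D} (hg : g ≠ 0) (ha : a ≠ 0)
    (h : a = w * g) (hle : size a ≤ size g) : ∃ z, g = z * a := by
  have hw : w ≠ 0 := by
    rintro rfl
    exact ha (by rw [h, zero_mul])
  have h1 := size_mul hw hg
  have h2 := size_pos.2 hw
  have h3 := size_pos.2 hg
  rw [← h] at h1
  obtain ⟨u, rfl⟩ := isUnit_of_size_eq_one (f := w) (by omega)
  exact ⟨((u⁻¹ : (SkewPolynomial D)ˣ) : SkewPolynomial D), by rw [h, Units.inv_mul_cancel_left]⟩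

open Classical in
/-- One round of the loop for the bound. -/
noncomputable def boundBody (κ : ArithCost D) (gens : List (SkewPolynomial D))
    (st : SkewPolynomial D × ℕ) : Comp (SkewPolynomial D × ℕ) := do
  let d := gens.getD st.2 0
  let p ← polyMul κ st.1 d
  let cr ← leftDiv κ p st.1
  if cr.2 = 0 then
    pure (st.1, st.2 + 1)
  else do
    let a ← annihilatorGen κ st.1 d
    let g ← leftLcm κ a st.1
    pure (g, 0)

theorem boundII_eq (κ : ArithCost D) (gens : List (SkewPolynomial D)) (f : SkewPolynomial D) :
    boundII κ gens f =
      (whileLoop (fun st : SkewPolynomial D × ℕ => st.2 < gens.length) (boundBody κ gens) (f, 0)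
        >>= fun fin => pure fin.1) :=
  rfl

variable {κ : ArithCost D} {S M I A : ℝ}

/-- Cost of the test whether `g * d` lies in `R g`. -/
theorem exists_haltsWithin_test (hκ : κ.BoundedBy S M I A) {g d : SkewPolynomial D} (hg : g ≠ 0)
    {m : ℕ} (hd : size d ≤ m + 1) :
    ∃ p c t b₁ b₂, HaltsWithin (polyMul κ g d) p b₁ ∧ HaltsWithin (leftDiv κ p g) (c, t) b₂ ∧
      b₁ + b₂ ≤ I + 4 * (m + 2) ^ 2 * (size g * (M + A + S)) ∧
      (t = 0 ↔ ∃ y, g * d = y * g) := by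
  obtain ⟨hS, hM, hI, hA⟩ := hκ.nonneg
  obtain ⟨c, t, h1, h2, h3⟩ := exists_haltsWithin_leftDiv hκ (g * d) hg
  refine ⟨g * d, c, t, _, _, haltsWithin_polyMul hκ g d, h1, ?_, ?_, ?_⟩
  · have hg' := size_pos.2 hg
    have hp := size_mul_le g d
    have hm0 : (0 : ℝ) ≤ m := Nat.cast_nonneg m
    have hF : (1 : ℝ) ≤ size g := by exact_mod_cast hg'
    have r1 : (size d : ℝ) ≤ m + 1 := by exact_mod_cast hd
    have r2 : ((size (g * d) + 1 - size g : ℕ) : ℝ) ≤ m + 1 := by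
      exact_mod_cast (by omega : size (g * d) + 1 - size g ≤ m + 1)
    have r3 : (size (g * d) : ℝ) ≤ size g + m := by
      exact_mod_cast (by omega : size (g * d) ≤ size g + m)
    clear h1
    set F : ℝ := ((size g : ℕ) : ℝ)
    have b1 : 2 * (F * size d) * (M + A + S) ≤ 2 * (F * (m + 1)) * (M + A + S) := by gcongr
    have b2 : ((size (g * d) + 1 - size g : ℕ) : ℝ) *
        ((F + 1) * (M + A) + (size (g * d) + 1) * S) ≤
        (m + 1) * (2 * F * (M + A) + ((m + 2) * F) * S) := by
      refine mul_le_mul r2 ?_ (by positivity) (by linarith)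
      refine add_le_add (mul_le_mul_of_nonneg_right (by linarith) (by linarith))
        (mul_le_mul_of_nonneg_right (by nlinarith) hS)
    have b3 : 0 ≤ F * (M + A) := by positivity
    have b4 : 0 ≤ F * S := by positivity
    have b5 := mul_nonneg hm0 b3
    have b6 := mul_nonneg hm0 b4
    have b7 := mul_nonneg hm0 b5
    have b8 := mul_nonneg hm0 b6
    linarith
  · intro h0
    exact ⟨c, by rw [h2, h0, add_zero]⟩
  · rintro ⟨y, hy⟩
    refine eq_zero_of_eq_mul_of_size_lt (w := y - c) ?_ h3
    rw [sub_mul, ← hy, h2, add_sub_cancel_left]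

/-- The update of `g` when `g * d` does not lie in `R g`. Here `b` generates a two-sided ideal. -/
theorem exists_haltsWithin_update (hκ : κ.BoundedBy S M I A) {b g d : SkewPolynomial D}
    (hg : g ≠ 0) {m : ℕ} (hd : size d ≤ m + 1) (hgd : ¬ ∃ y, g * d = y * g)
    (hb : ∃ c, b = c * g) (hbd : ∃ y, b * d = y * b) :
    ∃ a v b₁ b₂, HaltsWithin (annihilatorGen κ g d) a b₁ ∧
      HaltsWithin (leftLcm κ a g) (v * a) b₂ ∧ v * a ≠ 0 ∧
      (∃ c, b = c * (v * a)) ∧ (∃ y, v * a = y * g) ∧ size g < size (v * a) ∧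
      b₁ + b₂ ≤ ((size (v * a) : ℝ) - size g) *
        ((2 * m + 6) * I + 40 * (m + 2) ^ 2 * (size g * (M + A) + size g ^ 2 * S)) := by
  obtain ⟨hS, hM, hI, hA⟩ := hκ.nonneg
  have hd0 : d ≠ 0 := by
    rintro rfl
    exact hgd ⟨0, by simp⟩
  obtain ⟨a, h1, h2, ha, h3⟩ := exists_haltsWithin_annihilatorGen hκ hg hd0 hd
  have hga : ¬ ∃ z, g = z * a := fun h => hgd ((h2 g).2 h)
  obtain ⟨v, h4, h5, hv⟩ := exists_haltsWithin_leftLcm hκ hg h3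
    (fun c hc => hga (exists_eq_mul_of_size_le hg ha hc h3))
  obtain ⟨y, hy⟩ := (h5 v).2 ⟨1, (one_mul v).symm⟩
  have hva := mul_ne_zero hv ha
  -- Without growth, v a and g would be associated, so g would lie in R a, contrary to g d ∉ R g.
  have hlt : size g < size (v * a) := by
    by_contra hge
    obtain ⟨z, hz⟩ := exists_eq_mul_of_size_le hg hva hy (not_lt.1 hge)
    exact hga ⟨z * v, by rw [mul_assoc, ← hz]⟩
  refine ⟨a, v, _, _, h1, h4, hva, ?_, ⟨y, hy⟩, hlt, ?_⟩
  · obtain ⟨c, hc⟩ := hb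
    obtain ⟨c', hc'⟩ := hbd
    obtain ⟨z, hz⟩ := (h2 b).1 ⟨c' * c, by rw [hc', mul_assoc, ← hc]⟩
    obtain ⟨z', hz'⟩ := (h5 z).1 ⟨c, by rw [← hz, hc]⟩
    exact ⟨z', by rw [← mul_assoc, ← hz', hz]⟩
  · obtain ⟨y', hy'⟩ := (h2 a).2 ⟨1, (one_mul a).symm⟩
    have hy0 : y' ≠ 0 := by
      rintro rfl
      rw [zero_mul] at hy'
      exact mul_ne_zero ha hd0 hy'
    have e1 := size_le_size_mul_left (g := g) hy0
    rw [← hy', size_mul ha hd0] at e1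
    have e2 := size_mul hv ha
    have e3 := size_pos.2 ha
    have e4 := size_pos.2 hv
    have e5 := size_pos.2 hg
    have e6 := size_pos.2 hd0
    obtain ⟨δ, hδ⟩ := Nat.exists_eq_add_of_lt hlt
    have r1 : (size (v * a) : ℝ) - size g = δ + 1 := by
      have : (size (v * a) : ℝ) = size g + δ + 1 := by exact_mod_cast hδ
      linarith
    -- As a d is a nonzero multiple of g, deg a ≥ deg g - deg d. Hence deg v exceeds the gained
    -- degree by at most m.
    have r2 : (size v : ℝ) ≤ δ + m + 2 := by
      exact_mod_cast (by omega : size v ≤ δ + m + 2)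
    rw [r1]
    clear h1 h4
    have hF : (1 : ℝ) ≤ size g := by exact_mod_cast e5
    have hm0 : (0 : ℝ) ≤ m := Nat.cast_nonneg m
    have hδ0 : (0 : ℝ) ≤ δ := Nat.cast_nonneg δ
    set F : ℝ := ((size g : ℕ) : ℝ)
    have r3 : (size v : ℝ) ≤ (m + 2) * (δ + 1) := by nlinarith
    have b1 : size v * (I + 14 * F * (M + A + S)) ≤
        (m + 2) * (δ + 1) * (I + 14 * F * (M + A + S)) :=
      mul_le_mul_of_nonneg_right r3 (by positivity)
    have b2 : F * (M + A + S) ≤ F * (M + A) + F ^ 2 * S := by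
      have : F * S ≤ F ^ 2 * S := mul_le_mul_of_nonneg_right (by nlinarith) hS
      linarith
    set Q := F * (M + A) + F ^ 2 * S
    have hQ : 0 ≤ Q := by positivity
    have b3 : (m + 2) * (δ + 1) * (I + 14 * F * (M + A + S)) ≤
        (m + 2) * (δ + 1) * (I + 14 * Q) := by
      refine mul_le_mul_of_nonneg_left ?_ (by positivity)
      linarith
    have b4 := mul_nonneg hδ0 hI
    have b5 := mul_nonneg hδ0 hQ
    have b6 := mul_nonneg hm0 b4
    have b7 := mul_nonneg hm0 b5
    have b8 := mul_nonneg hm0 b7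
    have b9 := mul_nonneg hm0 hQ
    have b10 := mul_nonneg hm0 b9
    linarith

/-- The invariant of the loop for the bound; here `b` generates the annihilator of `R / R f`. -/
structure BoundInv (gens : List (SkewPolynomial D)) (f b : SkewPolynomial D)
    (st : SkewPolynomial D × ℕ) : Prop where
  ne_zero : st.1 ≠ 0
  bound : ∃ c, b = c * st.1
  mem : ∃ c, st.1 = c * f
  stable : ∀ j < st.2, ∃ y, st.1 * gens.getD j 0 = y * st.1
  le_length : st.2 ≤ gens.length

theorem exists_haltsWithin_boundBody (hκ : κ.BoundedBy S M I A) {gens : List (SkewPolynomial D)}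
    {m : ℕ} (hgens : ∀ d ∈ gens, size d ≤ m + 1) {f b : SkewPolynomial D} (hb0 : b ≠ 0)
    (hb : ∀ x, ∃ y, b * x = y * b) {st : SkewPolynomial D × ℕ} (hst : BoundInv gens f b st)
    (hlt : st.2 < gens.length) :
    ∃ st', BoundInv gens f b st' ∧
      ((st'.1 = st.1 ∧ st'.2 = st.2 + 1 ∧
        HaltsWithin (boundBody κ gens st) st'
          (I + 4 * (m + 2) ^ 2 * (size b * (M + A + S)))) ∨
      (size st.1 < size st'.1 ∧ size st'.1 ≤ size b ∧ st'.2 = 0 ∧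
        HaltsWithin (boundBody κ gens st) st'
          ((I + 4 * (m + 2) ^ 2 * (size b * (M + A + S))) + ((size st'.1 : ℝ) - size st.1) *
            ((2 * m + 6) * I + 40 * (m + 2) ^ 2 * (size b * (M + A) + size b ^ 2 * S))))) := by
  obtain ⟨hS, hM, hI, hA⟩ := hκ.nonneg
  obtain ⟨g, i⟩ := st
  obtain ⟨hg, hbg, hgf, hstab, -⟩ := hst
  simp only at hg hbg hgf hstab hlt ⊢
  have hsize : ∀ {g : SkewPolynomial D}, (∃ c, b = c * g) → size g ≤ size b := by
    rintro g ⟨c, rfl⟩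
    exact size_le_size_mul_left (left_ne_zero_of_mul hb0)
  have hgb : (size g : ℝ) ≤ size b := by exact_mod_cast hsize hbg
  set d := gens.getD i 0 with hd
  have hdm : size d ≤ m + 1 := by
    rw [hd, List.getD_eq_getElem _ _ hlt]
    exact hgens _ (List.getElem_mem hlt)
  obtain ⟨p, c, t, b₁, b₂, h1, h2, h3, h4⟩ := exists_haltsWithin_test hκ hg hdm
  have h5 : b₁ + b₂ ≤ I + 4 * (m + 2) ^ 2 * (size b * (M + A + S)) := h3.trans (by gcongr)
  by_cases ht : t = 0
  · refine ⟨(g, i + 1), ⟨hg, hbg, hgf, fun j hj => ?_, hlt⟩, Or.inl ⟨rfl, rfl, ?_⟩⟩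
    · rcases Nat.lt_succ_iff_lt_or_eq.1 hj with hj | rfl
      · exact hstab j hj
      · exact h4.1 ht
    · refine HaltsWithin.mono (b := b₁ + (b₂ + 0)) (HaltsWithin.bind h1
        (HaltsWithin.bind (a := (c, t)) h2 ?_)) (by linarith)
      rw [if_pos ht]
      exact haltsWithin_pure _
  · obtain ⟨a, v, b₃, b₄, h6, h7, h8, h9, ⟨y, hy⟩, h11, h12⟩ :=
      exists_haltsWithin_update hκ hg hdm (fun h => ht (h4.2 h)) hbg (hb d)
    refine ⟨(v * a, 0), ⟨h8, h9, ?_, fun j hj => absurd hj (Nat.not_lt_zero j), Nat.zero_le _⟩,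
      Or.inr ⟨h11, hsize h9, rfl, ?_⟩⟩
    · obtain ⟨z, hz⟩ := hgf
      exact ⟨y * z, by rw [hy, mul_assoc, ← hz]⟩
    · refine HaltsWithin.mono (b := b₁ + (b₂ + (b₃ + (b₄ + 0)))) (HaltsWithin.bind h1
        (HaltsWithin.bind (a := (c, t)) h2 ?_)) ?_
      · rw [if_neg ht]
        exact HaltsWithin.bind h6 (HaltsWithin.bind h7 (haltsWithin_pure _))
      · have h13 : (0 : ℝ) ≤ (size (v * a) : ℝ) - size g := by
          have : (size g : ℝ) ≤ size (v * a) := by exact_mod_cast h11.le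
          linarith
        have h14 : ((size (v * a) : ℝ) - size g) *
            ((2 * m + 6) * I + 40 * (m + 2) ^ 2 * (size g * (M + A) + size g ^ 2 * S)) ≤
            ((size (v * a) : ℝ) - size g) *
            ((2 * m + 6) * I + 40 * (m + 2) ^ 2 * (size b * (M + A) + size b ^ 2 * S)) := by
          gcongr
        linarith

/-- The loop for the bound, with the number of operations in terms of the degree of the bound. -/
theorem exists_haltsWithin_boundII (hκ : κ.BoundedBy S M I A) {gens : List (SkewPolynomial D)}
    {m : ℕ} (hgens : ∀ d ∈ gens, size d ≤ m + 1) {f b : SkewPolynomial D} (hf : 2 ≤ size f)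
    (hb0 : b ≠ 0) (hb : ∀ x, ∃ y, b * x = y * b) (hbf : ∃ c, b = c * f) :
    ∃ g, HaltsWithin (boundII κ gens f) g (200 * (m + 2) ^ 2 *
        (gens.length * ((size b : ℝ) - 1) * I +
          gens.length * ((size b : ℝ) - 1) ^ 2 * (M + A + S) + ((size b : ℝ) - 1) ^ 3 * S)) ∧
      BoundInv gens f b (g, gens.length) := by
  obtain ⟨hS, hM, hI, hA⟩ := hκ.nonneg
  set s := gens.length with hs
  set N : ℝ := ((size b : ℕ) : ℝ) with hN
  set T : ℝ := I + 4 * (m + 2) ^ 2 * (N * (M + A + S)) with hT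
  set U : ℝ := (2 * m + 6) * I + 40 * (m + 2) ^ 2 * (N * (M + A) + N ^ 2 * S) with hU
  have hT0 : 0 ≤ T := by positivity
  have hU0 : 0 ≤ U := by positivity
  have hf0 : f ≠ 0 := size_pos.1 (by omega)
  have hsize : ∀ {g : SkewPolynomial D}, (∃ c, b = c * g) → size g ≤ size b := by
    rintro g ⟨c, rfl⟩
    exact size_le_size_mul_left (left_ne_zero_of_mul hb0)
  -- This weight is 1 whenever the body runs. For s = 0 it is 0, so the update cost can be bounded
  -- both with and without a factor s.
  let σ : ℝ := min 1 s
  have hσ0 : 0 ≤ σ := le_min zero_le_one (Nat.cast_nonneg s)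
  have key := haltsWithin_whileLoop (cond := fun st : SkewPolynomial D × ℕ => st.2 < s)
    (body := boundBody κ gens) (BoundInv gens f b)
    (fun st => (size b - size st.1) * (s + 1) + (s - st.2))
    -- Each unit of degree still available prepays one update and a full pass of s tests; the last
    -- summand pays for the current pass. An update resets the index, and one prepaid pass covers
    -- both the reset and the failed test.
    (fun st => (N - size st.1) * (s * T + σ * U) + ((s : ℝ) - st.2) * T) ?_ (f, 0)
    ⟨hf0, hbf, ⟨1, (one_mul f).symm⟩, fun j hj => absurd hj (Nat.not_lt_zero j), Nat.zero_le _⟩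
  · obtain ⟨⟨g, i⟩, h1, h2, h3⟩ := key
    have hi : i = s := le_antisymm h2.le_length (not_lt.1 h3)
    subst hi
    refine ⟨g, ?_, h2⟩
    rw [boundII_eq]
    refine (h1.bind_pure (f := fun fin => fin.1)).mono ?_
    have r1 : (size g : ℝ) ≤ N := Nat.cast_le.2 (hsize h2.bound)
    have r2 : (2 : ℝ) ≤ size f := by exact_mod_cast hf
    have r3 : (2 : ℝ) ≤ N := r2.trans (Nat.cast_le.2 (hsize hbf))
    have hs0 : (0 : ℝ) ≤ gens.length := Nat.cast_nonneg _
    have hσ1 : σ ≤ 1 := min_le_left _ _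
    have hσs : σ ≤ gens.length := min_le_right _ _
    have hm0 : (0 : ℝ) ≤ m := Nat.cast_nonneg m
    have c1 : 0 ≤ (N - size g) * (gens.length * T + σ * U) :=
      mul_nonneg (by linarith) (by positivity)
    have c2 : (N - size f) * (gens.length * T + σ * U) ≤ (N - 2) * (gens.length * T + σ * U) :=
      mul_le_mul_of_nonneg_right (by linarith) (by positivity)
    obtain ⟨G, hG⟩ : ∃ G, G = N - 1 := ⟨_, rfl⟩
    have hNG : N = G + 1 := by linarith
    have hG1 : 1 ≤ G := by linarith
    have hN2 : N ≤ 2 * G := by linarith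
    have hG0 : 0 ≤ G := by linarith
    have hN0 : 0 ≤ N := by linarith
    have c3 : (gens.length : ℝ) * T ≤
        gens.length * (I + 4 * (m + 2) ^ 2 * (2 * G * (M + A + S))) := by
      rw [hT]
      gcongr
    have c4 : σ * U ≤ gens.length * ((2 * m + 6) * I) +
        40 * (m + 2) ^ 2 * (gens.length * (2 * G * (M + A)) + 4 * G ^ 2 * S) := by
      have d1 : σ * ((2 * m + 6) * I) ≤ gens.length * ((2 * m + 6) * I) := by gcongr
      have d2 : σ * (N * (M + A)) ≤ gens.length * (2 * G * (M + A)) := by gcongr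
      have d3 : σ * (N ^ 2 * S) ≤ 1 * ((2 * G) ^ 2 * S) := by gcongr
      have d4 : 40 * ((m : ℝ) + 2) ^ 2 * (σ * (N * (M + A)) + σ * (N ^ 2 * S)) ≤
          40 * (m + 2) ^ 2 * (gens.length * (2 * G * (M + A)) + 4 * G ^ 2 * S) := by
        refine mul_le_mul_of_nonneg_left ?_ (by positivity)
        linarith
      rw [hU]
      linarith
    -- As `size f ≥ 2`, at most N - 2 units of degree remain; the first pass of tests completes the
    -- factor N - 1.
    have c5 : (N - 2) * (gens.length * T + σ * U) + gens.length * T ≤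
        G * (gens.length * T + σ * U) := by
      have : 0 ≤ σ * U := mul_nonneg hσ0 hU0
      rw [hNG]
      linarith
    have c6 := mul_le_mul_of_nonneg_left (add_le_add c3 c4) hG0
    rw [show (N - 1 : ℝ) = G from hG.symm]
    have d1 : 0 ≤ (gens.length : ℝ) * G * I := by positivity
    have d2 : 0 ≤ (gens.length : ℝ) * G ^ 2 * (M + A) := by positivity
    have d3 : 0 ≤ (gens.length : ℝ) * G ^ 2 * S := by positivity
    have d4 : 0 ≤ G ^ 3 * S := by positivity
    have d5 := mul_nonneg hm0 d1
    have d6 := mul_nonneg hm0 d2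
    have d7 := mul_nonneg hm0 d3
    have d8 := mul_nonneg hm0 d4
    have d9 := mul_nonneg hm0 d5
    have d10 := mul_nonneg hm0 d6
    have d11 := mul_nonneg hm0 d7
    have d12 := mul_nonneg hm0 d8
    simp only [Nat.cast_zero, sub_zero, sub_self, zero_mul, add_zero]
    linarith
  · intro st hst hlt
    obtain ⟨st', h1, h2⟩ := exists_haltsWithin_boundBody hκ hgens hb0 hb hst hlt
    have hlt' : (st.2 : ℝ) + 1 ≤ s := by exact_mod_cast hlt
    have hσ : σ = 1 := min_eq_left (by linarith [(Nat.cast_nonneg st.2 : (0 : ℝ) ≤ st.2)])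
    refine ⟨st', ?_, h1, ?_⟩
    · rcases h2 with ⟨e1, e2, h3⟩ | ⟨e1, e2, e3, h3⟩
      · refine h3.mono (le_of_eq ?_)
        rw [e1, e2]
        push_cast
        ring
      · refine h3.mono ?_
        rw [e3, hσ]
        have r1 : (size st.1 : ℝ) + 1 ≤ size st'.1 := by exact_mod_cast e1
        have r2 : 1 * (s * T) ≤ ((size st'.1 : ℝ) - size st.1) * (s * T) :=
          mul_le_mul_of_nonneg_right (by linarith) (by positivity)
        have r3 : ((st.2 : ℝ) + 1) * T ≤ s * T := mul_le_mul_of_nonneg_right hlt' hT0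
        push_cast
        linarith
    · rcases h2 with ⟨e1, e2, -⟩ | ⟨e1, e2, e3, -⟩
      · rw [e1, e2]
        omega
      · rw [e3]
        obtain ⟨k, hk⟩ : ∃ k, size b - size st.1 = size b - size st'.1 + 1 + k :=
          ⟨_, (Nat.add_sub_of_le (by omega)).symm⟩
        rw [hk]
        have : (size b - size st'.1 + 1 + k) * (s + 1) =
          (size b - size st'.1) * (s + 1) + (s + 1) + k * (s + 1) := by ring
        omega

/-- When all generators have been tested successfully, the result is a bound. -/
theorem BoundInv.isBound (hφ : Function.Surjective (φ : D → D)) {gens : List (SkewPolynomial D)}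
    (hadj : Algebra.adjoin (Subring.center (SkewPolynomial D)) {d | d ∈ gens} = ⊤)
    {f b g : SkewPolynomial D}
    (hb : Module.annihilator (SkewPolynomial D) (SkewPolynomial D ⧸ Ideal.span {f}) =
      Ideal.span {b})
    (h : BoundInv gens f b (g, gens.length)) : IsBound f g := by
  have hg : ∀ x, ∃ y, g * x = y * g := by
    let T : Subalgebra (Subring.center (SkewPolynomial D)) (SkewPolynomial D) :=
      { carrier := {x | ∃ y, g * x = y * g}
        mul_mem' := by
          rintro x x' ⟨y, hy⟩ ⟨y', hy'⟩
          exact ⟨y * y', by rw [← mul_assoc, hy, mul_assoc, hy', mul_assoc]⟩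
        add_mem' := by
          rintro x x' ⟨y, hy⟩ ⟨y', hy'⟩
          exact ⟨y + y', by rw [mul_add, hy, hy', add_mul]⟩
        algebraMap_mem' := fun z => ⟨z, Subring.mem_center_iff.1 z.2 g⟩ }
    have hT : Algebra.adjoin (Subring.center (SkewPolynomial D)) {d | d ∈ gens} ≤ T := by
      refine Algebra.adjoin_le fun d hd => ?_
      obtain ⟨i, hi, rfl⟩ := List.getElem_of_mem hd
      have := h.stable i hi
      rwa [List.getD_eq_getElem _ _ hi] at this
    rw [hadj] at hT
    exact fun x => hT Algebra.mem_top
  obtain ⟨c, hc⟩ := h.mem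
  obtain ⟨c', hc'⟩ := h.bound
  refine ⟨?_, fun x => ⟨fun hx => ?_, ?_⟩⟩
  · refine le_antisymm ?_ ((Ideal.span_singleton_le_iff_mem _).2 ?_)
    · rw [hb, Ideal.span_singleton_le_iff_mem]
      exact Ideal.mem_span_singleton'.2 ⟨c', hc'.symm⟩
    · refine mem_annihilator_quotient_iff.2 fun x => ?_
      obtain ⟨y, hy⟩ := hg x
      exact ⟨y * c, by rw [hy, mul_assoc, ← hc]⟩
  · obtain ⟨y, rfl⟩ := Ideal.mem_span_singleton'.1 hx
    exact exists_mul_eq_of_twoSided hφ h.ne_zero hg y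
  · rintro ⟨a, rfl⟩
    obtain ⟨y, hy⟩ := hg a
    exact Ideal.mem_span_singleton'.2 ⟨y, hy.symm⟩

end Bound

/-! ### From the degree of the bound to the stated estimate. -/

theorem le_mul_costBound {r s n : ℕ} {S M I A K G c : ℝ} (hS : 0 ≤ S) (hM : 0 ≤ M) (hI : 0 ≤ I)
    (hA : 0 ≤ A) (hK : 0 ≤ K) (hG1 : 1 ≤ G) (hG : G ≤ √(r : ℝ) * n)
    (hc : c ≤ K * (s * G * I + s * G ^ 2 * (M + A + S) + G ^ 3 * S)) :
    ((s : ℝ) ≤ √(r : ℝ) * n ∨ S ≤ M → c ≤ 2 * K * costBound r s n S M I A) ∧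
      c ≤ 2 * K * (s + 1) * costBound r s n S M I A := by
  obtain ⟨ρ, hρ⟩ : ∃ ρ, ρ = √(r : ℝ) * n := ⟨_, rfl⟩
  have hr : √(r : ℝ) ^ 2 = r := Real.sq_sqrt (Nat.cast_nonneg r)
  have hB : costBound r s n S M I A = s * ρ * I + ρ ^ 3 * S + s * ρ ^ 2 * (M + A) := by
    rw [costBound, hρ, mul_pow, mul_pow, hr, pow_succ (√(r : ℝ)) 2, hr]
    ring
  rw [hB]
  rw [← hρ] at hG ⊢
  have hs : (0 : ℝ) ≤ s := Nat.cast_nonneg s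
  have hG0 : 0 ≤ G := by linarith
  have hρ1 : 1 ≤ ρ := hG1.trans hG
  have hρ0 : 0 ≤ ρ := by linarith
  have h1 : c ≤ K * (s * ρ * I + s * ρ ^ 2 * (M + A + S) + ρ ^ 3 * S) := hc.trans (by gcongr)
  have e1 : 0 ≤ s * ρ * I := by positivity
  have e2 : 0 ≤ ρ ^ 3 * S := by positivity
  have e3 : 0 ≤ s * ρ ^ 2 * M := by positivity
  have e4 : 0 ≤ s * ρ ^ 2 * A := by positivity
  constructor
  · intro h
    -- The one excess term: it is at most ρ³S if s ≤ ρ, and at most sρ²M if S ≤ M. In general ρ ≥ 1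
    -- gives sρ²S ≤ s·ρ³S, which costs the factor s + 1.
    have h2 : s * ρ ^ 2 * S ≤ s * ρ * I + ρ ^ 3 * S + s * ρ ^ 2 * (M + A) := by
      rcases h with h | h
      · have : s * ρ ^ 2 * S ≤ ρ * ρ ^ 2 * S := by gcongr
        nlinarith
      · have : s * ρ ^ 2 * S ≤ s * ρ ^ 2 * M := by gcongr
        linarith
    have h3 := mul_le_mul_of_nonneg_left h2 hK
    linarith
  · have h2 : s * ρ ^ 2 * S ≤ s * (s * ρ * I + ρ ^ 3 * S + s * ρ ^ 2 * (M + A)) := by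
      have : s * ρ ^ 2 * S ≤ s * (ρ ^ 3 * S) := by
        rw [← mul_assoc]
        gcongr
        · norm_num
      have : 0 ≤ s * (s * ρ * I) := by positivity
      have : 0 ≤ s * (s * ρ ^ 2 * (M + A)) := by positivity
      linarith
    have h3 := mul_le_mul_of_nonneg_left h2 hK
    have h4 : 0 ≤ K * (s * ρ * I + ρ ^ 3 * S + s * ρ ^ 2 * (M + A)) := by positivity
    have h5 := mul_nonneg hs h4
    linarith

end OreBound

theorem theorem4p5 (m : ℕ) :
    ∃ C : ℝ,
      ∀ (D : Type*) [DivisionRing D] [MulSemiringAction (Multiplicative ℕ) D]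
        [Module.Finite (Subring.center D) D]
        (σ : RingAut D) (_ : ∀ a : D, σ a = SkewPolynomial.φ a) (_ : IsOfFinOrder σ)
        (κ : OreBound.ArithCost D) (S M I A : ℕ → ℝ) (μ : ℕ)
        (_ : μ = Module.finrank (OreBound.invariantCenter σ) D)
        (_ : κ.BoundedBy (S μ) (M μ) (I μ) (A μ))
        (r : ℕ) (_ : r = OreBound.centerRank D)
        (s : ℕ) (gens : List (SkewPolynomial D)) (_ : gens.length = s)
        (_ : Algebra.adjoin (Subring.center (SkewPolynomial D)) {d | d ∈ gens} = ⊤)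
        (_ : ∀ d ∈ gens, OreBound.natDegree d ≤ m)
        (n : ℕ) (_ : 1 ≤ n) (f : SkewPolynomial D) (_ : OreBound.natDegree f = n),
        ∃ (g : SkewPolynomial D) (c : ℕ),
          OreBound.Halts (OreBound.boundII κ gens f) g c ∧
          OreBound.IsBound f g ∧
          ((s : ℝ) ≤ √(r : ℝ) * n ∨ S μ ≤ M μ →
            (c : ℝ) ≤ C * OreBound.costBound r s n (S μ) (M μ) (I μ) (A μ)) ∧
          (c : ℝ) ≤ C * (s + 1) * OreBound.costBound r s n (S μ) (M μ) (I μ) (A μ) := by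
  -- The factor 200 (m + 2)² comes from the loop, the factor 2 from absorbing the excess additions.
  refine ⟨2 * (200 * (m + 2) ^ 2), ?_⟩
  intro D _ _ _ σ hσφ hσ κ S M I A μ _ hκ r hr s gens hs hadj hgens n hn f hf
  have hφ : Function.Surjective (SkewPolynomial.φ : D → D) := fun a =>
    ⟨σ.symm a, by rw [← hσφ, RingEquiv.apply_symm_apply]⟩
  have hfin := OreBound.finite_over_center hσφ hσ
  have hsz : OreBound.size f = n + 1 := by
    have := OreBound.natDegree_eq_size_sub_one f
    omega
  have hf0 : f ≠ 0 := OreBound.size_pos.1 (by omega)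
  obtain ⟨b, hb0, hb, hbn⟩ := OreBound.exists_annihilator_eq_span hf0
  have hbmem : ∀ x, ∃ y, b * x = y * f := OreBound.mem_annihilator_quotient_iff.1
    (hb ▸ Ideal.mem_span_singleton_self b)
  have hb2 : ∀ x, ∃ y, b * x = y * b := by
    intro x
    have h1 : b * x ∈ Module.annihilator (SkewPolynomial D)
        (SkewPolynomial D ⧸ Ideal.span {f}) := by
      refine OreBound.mem_annihilator_quotient_iff.2 fun y => ?_
      rw [mul_assoc]
      exact hbmem _
    rw [hb] at h1
    obtain ⟨y, hy⟩ := Ideal.mem_span_singleton'.1 h1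
    exact ⟨y, hy.symm⟩
  have hbf : ∃ c, b = c * f := by
    obtain ⟨c, hc⟩ := hbmem 1
    exact ⟨c, by rw [← hc, mul_one]⟩
  obtain ⟨g, ⟨c, h1, h2⟩, h3⟩ := OreBound.exists_haltsWithin_boundII hκ
    (fun d hd => (OreBound.size_le_natDegree_add_one d).trans
      (Nat.add_le_add_right (hgens d hd) 1)) (by omega) hb0 hb2 hbf
  obtain ⟨hS, hM, hI, hA⟩ := hκ.nonneg
  have hG : (OreBound.size b : ℝ) - 1 ≤ √(r : ℝ) * n := by
    rw [hsz, ← hr] at hbn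
    push_cast at hbn
    linarith
  have hG1 : 1 ≤ (OreBound.size b : ℝ) - 1 := by
    obtain ⟨y, hy⟩ := hbf
    have h4 : y ≠ 0 := by
      rintro rfl
      exact hb0 (by rw [hy, zero_mul])
    have h5 := OreBound.size_le_size_mul_left (g := f) h4
    rw [← hy, hsz] at h5
    have : (2 : ℝ) ≤ OreBound.size b := by exact_mod_cast (by omega : 2 ≤ OreBound.size b)
    linarith
  rw [hs] at h2
  have h6 := OreBound.le_mul_costBound hS hM hI hA (by positivity) hG1 hG h2
  exact ⟨g, c, h1, h3.isBound hφ hadj hb, h6.1, h6.2⟩
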